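/- Let $\kappa>0$, $D_\kappa=\pi/\sqrt\kappa$, let $(X,d)$ be a complete CAT$(\kappa)$ space, $C\subseteq X$ a bounded closed convex subset (it contains every geodesic segment of $X$ joining two of its points), $T:C\to C$ a nonexpansive mapping, and let $0<M<\frac{D_\kappa}{2}$ be an upper bound on the diameter of $C$. Let $\mathbb Z_+=\{1,2,\dots\}$, let $(\lambda_n)_{n\ge1}$ be a sequence in $[0,1]$ and let $\alpha,\gamma:(0,\infty)\to\mathbb Z_+$, $\theta:\mathbb Z_+\to\mathbb Z_+$ satisfy \begin{itemize} \item $\lambda_{n+1}\le\delta$ for all $\delta>0$ and all $n\ge\alpha(\delta)$; \item $\sum_{i=\gamma(\delta)+1}^{\gamma(\delta)+n}|\lambda_{i+1}-\lambda_i|\le\delta$ for all $\delta>0$ and all $n\in\mathbb Z_+$; \item $\sum_{k=1}^{\theta(n)}\lambda_{k+1}\ge n$ for all $n\in\mathbb Z_+$. \end{itemize} For $u\in C$ let $(x_n)$ be the Halpern iteration $x_0=u$, $x_{n+1}=\lambda_{n+1}u+(1-\lambda_{n+1})Tx_n$, where $(1-t)x+ty$ denotes the point $z$ of the geodesic segment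 $[x,y]$ with $d(z,x)=t\,d(x,y)$ and $d(z,y)=(1-t)\,d(x,y)$. For $\varepsilon\in(0,2)$ with $\sin\frac{\varepsilon\sqrt\kappa}{4}\ne0$, $g:\mathbb N\to\mathbb N$, $i,n\in\mathbb N$ and $\delta>0$ put $c=\left\lceil\frac1{\cos(M\sqrt\kappa)}\right\rceil$, $\sigma=\sin^2\frac{\varepsilon\sqrt\kappa}{4}$ and $$\varepsilon_0=\frac{\cos(M\sqrt\kappa)}{36}\,\sigma,\qquad B=\left\lceil\frac{M\sqrt\kappa\tan(M\sqrt\kappa)}{1-\cos\varepsilon_0}\right\rceil,\qquad L_i(\delta)=\frac{\cos(M\sqrt\kappa)\,\delta}{4M\sqrt\kappa\,(i+1)},$$ $$\chi_i(\delta)=\max\left\{\theta\left(c\left(\gamma(L_i(\delta))+\max\left\{\left\lceil\ln\tfrac1{L_i(\delta)}\right\rceil,1\right\}\right)\right),\ \alpha(2L_i(\delta))\right\},\qquad \chi_i^*(\delta)=\chi_i\left(\tfrac\delta2\cos(M\sqrt\kappa)\right),$$ $$\Theta_i(\delta)=\theta\left(c\left(\chi_i^*\left(\tfrac\delta3\right)-1+\max\left\{\left\lceil\ln\left(\tfrac3\delta\sin^2\tfrac{M\sqrt\kappa}2\right)\right\rceil,1\right\}\right)\right)+1,$$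 $$\Delta_i^*(\delta,g)=\frac{\delta}{3\Theta_i(\delta)-3\chi_i^*(\frac\delta3)+3g(\Theta_i(\delta))},\qquad f(i)=\max\left\{\left\lceil\frac{M\sqrt\kappa}{\Delta_i^*(\sigma,g)}\right\rceil,i\right\}-i,$$ $$f^*(i)=f\left(i+\left\lceil\tfrac1{\varepsilon_0}\right\rceil\right)+\left\lceil\tfrac1{\varepsilon_0}\right\rceil,\qquad \widetilde{f^*}(i)=i+f^*(i),$$ $$\Gamma(n)=\max\left\{\chi_i^*\left(\tfrac\sigma3\right):\left\lceil\tfrac1{\varepsilon_0}\right\rceil\le i\le n\right\},\qquad \theta^+(n)=\max_{1\le i\le n}\theta(i),\qquad S=\left\lceil\ln\frac{3\sin^2\frac{M\sqrt\kappa}{2}}{\sigma}\right\rceil,$$ $$A(n)=\theta^+\left(c\left(\Gamma(n)-1+\max\{S,1\}\right)\right)+1,\qquad \Sigma(\varepsilon,g,\kappa,M,\theta,\alpha,\gamma)=A\left(\widetilde{f^*}^{(B)}(0)+\left\lceil\tfrac1{\varepsilon_0}\right\rceil\right),$$ where $\widetilde{f^*}^{(B)}$ is the $B$-th iterate of $\widetilde{f^*}$.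 Then for all $\varepsilon\in(0,2)$ with $\sin\frac{\varepsilon\sqrt\kappa}{4}\neq0$ and all $g:\mathbb N\to\mathbb N$ there is $N\le\Sigma(\varepsilon,g,\kappa,M,\theta,\alpha,\gamma)$ with $$d(x_n,x_m)\le\varepsilon\quad\text{for all } m,n\in[N,N+g(N)];$$ moreover, $N$ can be taken of the form $N=\Theta_{K_0}\left(\sin^2\frac{\varepsilon\sqrt\kappa}4\right)$ for some $K_0\in\mathbb N$ with $\left\lceil\frac1{\varepsilon_0}\right\rceil\le K_0\le\widetilde{f^*}^{(B)}(0)+\left\lceil\frac1{\varepsilon_0}\right\rceil$. The rate $\Sigma$ depends only on the arguments shown, not on $u$ or $T$, and on $X$ and $C$ only through $\kappa$ and $M$. -/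

import Mathlib

noncomputable section

namespace Halpern

/-! ### Geodesics, model spaces and CAT(κ) spaces -/

/-- `c`, restricted to `[0, dist x y]`, is a geodesic path from `x` to `y`
(the length of the parameter interval of such a path is necessarily `dist x y`). -/
structure IsGeodesicPath {X : Type*} [MetricSpace X] (c : ℝ → X) (x y : X) : Prop where
  source : c 0 = x
  target : c (dist x y) = y
  isometry : ∀ s ∈ Set.Icc 0 (dist x y), ∀ t ∈ Set.Icc 0 (dist x y), dist (c s) (c t) = |s - t|

/-- `z = (1 - t) x + t y`, in the metric sense. -/
def IsConvexComb {X : Type*} [MetricSpace X] (t : ℝ) (x y z : X) : Prop :=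
  dist z x = t * dist x y ∧ dist z y = (1 - t) * dist x y

/-- `C` contains every geodesic segment that joins two of its points. -/
def GeodesicConvex {X : Type*} [MetricSpace X] (C : Set X) : Prop :=
  ∀ x ∈ C, ∀ y ∈ C, ∀ c : ℝ → X, IsGeodesicPath c x y → ∀ t ∈ Set.Icc 0 (dist x y), c t ∈ C

/-- The set of points of the model surface: the unit sphere of Euclidean 3-space. -/
abbrev ModelSphere : Type := Metric.sphere (0 : EuclideanSpace ℝ (Fin 3)) 1

/-- The distance of the model surface of curvature `κ > 0`: the spherical (angular) distance
divided by `√κ`. -/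
def modelDist (κ : ℝ) (p q : ModelSphere) : ℝ :=
  Real.arccos (inner ℝ (p : EuclideanSpace ℝ (Fin 3)) (q : EuclideanSpace ℝ (Fin 3))) / √κ

/-- The diameter `π / √κ` of the model surface. -/
def modelDiam (κ : ℝ) : ℝ := Real.pi / √κ

/-- The CAT(κ) inequality for the geodesic triangle with vertices `p 0, p 1, p 2` and edges
`c i` from `p i` to `p (i + 1)` (indices modulo 3): for every comparison triangle `q` in the
model surface, all points `c i s`, `c j t` of the triangle and their comparison points `a`, `b`
on the corresponding edges of `q`, `dist (c i s) (c j t)` is at most the distance of `a`, `b`. -/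
def CATInequality {X : Type*} [MetricSpace X] (κ : ℝ) (p : Fin 3 → X) (c : Fin 3 → ℝ → X) :
    Prop :=
  ∀ q : Fin 3 → ModelSphere, (∀ i j, modelDist κ (q i) (q j) = dist (p i) (p j)) →
    ∀ i j : Fin 3, ∀ s ∈ Set.Icc 0 (dist (p i) (p (i + 1))),
      ∀ t ∈ Set.Icc 0 (dist (p j) (p (j + 1))), ∀ a b : ModelSphere,
        modelDist κ a (q i) = s → modelDist κ a (q (i + 1)) = dist (p i) (p (i + 1)) - s →
        modelDist κ b (q j) = t → modelDist κ b (q (j + 1)) = dist (p j) (p (j + 1)) - t →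
        dist (c i s) (c j t) ≤ modelDist κ a b

/-- `X` is a CAT(κ) space (`κ > 0`): points at distance less than `π / √κ` are joined by a
geodesic, and every geodesic triangle of perimeter less than `2 π / √κ` satisfies the CAT(κ)
inequality. -/
structure IsCAT (κ : ℝ) (X : Type*) [MetricSpace X] : Prop where
  exists_geodesic : ∀ x y : X, dist x y < modelDiam κ → ∃ c : ℝ → X, IsGeodesicPath c x y
  comparison : ∀ (p : Fin 3 → X) (c : Fin 3 → ℝ → X),
    (∀ i, IsGeodesicPath (c i) (p i) (p (i + 1))) →
    dist (p 0) (p 1) + dist (p 1) (p 2) + dist (p 2) (p 0) < 2 * modelDiam κ →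
    CATInequality κ p c

/-! ### The Halpern iteration and the condition on the parameters -/

/-- `x` is the Halpern iteration of `T` with parameters `lam` started at `u`:
`x₀ = u` and `xₙ₊₁ = lamₙ₊₁ u + (1 - lamₙ₊₁) T xₙ`. -/
def IsHalpernIteration {X : Type*} [MetricSpace X] (T : X → X) (lam : ℕ → ℝ) (u : X)
    (x : ℕ → X) : Prop :=
  x 0 = u ∧ ∀ n, IsConvexComb (1 - lam (n + 1)) u (T (x n)) (x (n + 1))

/-- The quantitative hypotheses on `(lamₙ)`, `n ≥ 1`. The functions `α, γ : (0, ∞) → {1, 2, …}`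
and `θ : {1, 2, …} → {1, 2, …}` are represented by total functions, of which only the values on
these domains matter. -/
structure RateConditions (lam : ℕ → ℝ) (α γ : ℝ → ℕ) (θ : ℕ → ℕ) : Prop where
  alpha_pos : ∀ ε > 0, 1 ≤ α ε
  gamma_pos : ∀ ε > 0, 1 ≤ γ ε
  theta_pos : ∀ n, 1 ≤ n → 1 ≤ θ n
  /-- `lamₙ₊₁ → 0` with rate of convergence `α`. -/
  tendsto : ∀ ε > 0, ∀ n, α ε ≤ n → lam (n + 1) ≤ ε
  /-- `∑ |lamₙ₊₁ - lamₙ|` converges with Cauchy modulus `γ`. -/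
  cauchy : ∀ ε > 0, ∀ n, 1 ≤ n →
    ∑ i ∈ Finset.Icc (γ ε + 1) (γ ε + n), |lam (i + 1) - lam i| ≤ ε
  /-- `∑ lamₙ₊₁` diverges with rate of divergence `θ`. -/
  diverges : ∀ n : ℕ, 1 ≤ n → (n : ℝ) ≤ ∑ k ∈ Finset.Icc 1 (θ n), lam (k + 1)

/-! ### The constants and functionals of the rate of metastability -/

/-- `ε₀ = (cos (M√κ) / 36) sin² (ε√κ / 4)`. -/
def eps0 (ε κ M : ℝ) : ℝ := Real.cos (M * √κ) / 36 * Real.sin (ε * √κ / 4) ^ 2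

/-- `⌈1 / ε₀⌉`. -/
def ceilInvEps0 (ε κ M : ℝ) : ℕ := ⌈1 / eps0 ε κ M⌉₊

/-- `⌈1 / cos (M√κ)⌉`. -/
def ceilInvCos (κ M : ℝ) : ℕ := ⌈1 / Real.cos (M * √κ)⌉₊

/-- `B = ⌈M√κ tan (M√κ) / (1 - cos ε₀)⌉`. -/
def B (ε κ M : ℝ) : ℕ :=
  ⌈M * √κ * Real.tan (M * √κ) / (1 - Real.cos (eps0 ε κ M))⌉₊

/-- `L_i = cos (M√κ) δ / (4 M√κ (i + 1))`. -/
def L (κ M : ℝ) (i : ℕ) (δ : ℝ) : ℝ :=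
  Real.cos (M * √κ) * δ / (4 * M * √κ * ((i : ℝ) + 1))

/-- `χ_i(δ)`. -/
def chi (κ M : ℝ) (θ : ℕ → ℕ) (α γ : ℝ → ℕ) (i : ℕ) (δ : ℝ) : ℕ :=
  max (θ (ceilInvCos κ M * (γ (L κ M i δ) + max ⌈Real.log (1 / L κ M i δ)⌉₊ 1)))
    (α (2 * L κ M i δ))

/-- `χ*_i(δ) = χ_i((δ / 2) cos (M√κ))`. -/
def chiStar (κ M : ℝ) (θ : ℕ → ℕ) (α γ : ℝ → ℕ) (i : ℕ) (δ : ℝ) : ℕ :=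
  chi κ M θ α γ i (δ / 2 * Real.cos (M * √κ))

/-- `⌈ln ((3 / δ) sin² (M√κ / 2))⌉`, truncated below at `0`; it only enters through its maximum
with `1`. -/
def logTerm (κ M δ : ℝ) : ℕ := ⌈Real.log (3 / δ * Real.sin (M * √κ / 2) ^ 2)⌉₊

/-- `Θ_i(δ)`. The subtraction is not truncated, since `χ*_i ≥ 1`. -/
def Theta (κ M : ℝ) (θ : ℕ → ℕ) (α γ : ℝ → ℕ) (i : ℕ) (δ : ℝ) : ℕ :=
  θ (ceilInvCos κ M * (chiStar κ M θ α γ i (δ / 3) - 1 + max (logTerm κ M δ) 1)) + 1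

/-- `Δ*_i(δ, g)`. -/
def DeltaStar (κ M : ℝ) (θ : ℕ → ℕ) (α γ : ℝ → ℕ) (i : ℕ) (δ : ℝ) (g : ℕ → ℕ) : ℝ :=
  δ / (3 * (Theta κ M θ α γ i δ : ℝ) - 3 * (chiStar κ M θ α γ i (δ / 3) : ℝ)
    + 3 * (g (Theta κ M θ α γ i δ) : ℝ))

/-- `f(i) = max {⌈M√κ / Δ*_i(sin² (ε√κ / 4), g)⌉, i} - i`. -/
def f (ε : ℝ) (g : ℕ → ℕ) (κ M : ℝ) (θ : ℕ → ℕ) (α γ : ℝ → ℕ) (i : ℕ) : ℕ :=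
  max ⌈M * √κ / DeltaStar κ M θ α γ i (Real.sin (ε * √κ / 4) ^ 2) g⌉₊ i - i

/-- `f*(i) = f(i + ⌈1/ε₀⌉) + ⌈1/ε₀⌉`. -/
def fStar (ε : ℝ) (g : ℕ → ℕ) (κ M : ℝ) (θ : ℕ → ℕ) (α γ : ℝ → ℕ) (i : ℕ) : ℕ :=
  f ε g κ M θ α γ (i + ceilInvEps0 ε κ M) + ceilInvEps0 ε κ M

/-- `f̃*(i) = i + f*(i)`. -/
def fTilde (ε : ℝ) (g : ℕ → ℕ) (κ M : ℝ) (θ : ℕ → ℕ) (α γ : ℝ → ℕ) (i : ℕ) : ℕ :=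
  i + fStar ε g κ M θ α γ i

/-- The `B`-th iterate of `f̃*` at `0`, plus `⌈1/ε₀⌉`. -/
def Kbound (ε : ℝ) (g : ℕ → ℕ) (κ M : ℝ) (θ : ℕ → ℕ) (α γ : ℝ → ℕ) : ℕ :=
  (fTilde ε g κ M θ α γ)^[B ε κ M] 0 + ceilInvEps0 ε κ M

/-- `θ⁺(n) = max {θ(i) : 1 ≤ i ≤ n}`. -/
def thetaPlus (θ : ℕ → ℕ) (n : ℕ) : ℕ := (Finset.Icc 1 n).sup θ

/-- `Γ(n) = max {χ*_i((1/3) sin² (ε√κ / 4)) : ⌈1/ε₀⌉ ≤ i ≤ n}`. -/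
def Gamma (ε κ M : ℝ) (θ : ℕ → ℕ) (α γ : ℝ → ℕ) (n : ℕ) : ℕ :=
  (Finset.Icc (ceilInvEps0 ε κ M) n).sup
    fun i => chiStar κ M θ α γ i (1 / 3 * Real.sin (ε * √κ / 4) ^ 2)

/-- `S = ⌈ln (3 sin² (M√κ / 2) / sin² (ε√κ / 4))⌉`, truncated below at `0`; it only enters
through its maximum with `1`. -/
def S (ε κ M : ℝ) : ℕ :=
  ⌈Real.log (3 * Real.sin (M * √κ / 2) ^ 2 / Real.sin (ε * √κ / 4) ^ 2)⌉₊

/-- `A(n) = θ⁺(⌈1 / cos (M√κ)⌉ (Γ(n) - 1 + max {S, 1})) + 1`. -/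
def A (ε κ M : ℝ) (θ : ℕ → ℕ) (α γ : ℝ → ℕ) (n : ℕ) : ℕ :=
  thetaPlus θ (ceilInvCos κ M * (Gamma ε κ M θ α γ n - 1 + max (S ε κ M) 1)) + 1

/-- The rate of metastability `Σ(ε, g, κ, M, θ, α, γ)`. -/
def metastabilityRate (ε : ℝ) (g : ℕ → ℕ) (κ M : ℝ) (θ : ℕ → ℕ) (α γ : ℝ → ℕ) : ℕ :=
  A ε κ M θ α γ (Kbound ε g κ M θ α γ)

end Halpern

end

/-!
Everything happens in the metric `√κ d`, in which `C` has diameter at most `m = M√κ < π / 2`.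
The only geometric input is the CAT(κ) inequality between a vertex of a triangle and a point of the
opposite side, in cosine form (`cos_dist_convexComb_ge`); it is read off an explicit comparison
triangle in the unit sphere. Applied twice, it compares two geodesics issuing from one point
(`SphericallyConvex.cos_comparison`), and so shows that moving towards `u` by a fixed ratio is a
contraction (`SphericallyConvex.angDist_convexComb_le`). Hence the resolvents
`z i = u / (i + 1) + (1 - 1 / (i + 1)) T (z i)` exist.

The resolvents. With growing index they move away from `u`, and the angle at the earlier of two
resolvents between `u` and the later one is at least `π / 2`
(`SphericallyConvex.resolvent_mono`). Their distance is thus controlled by the increment of the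
bounded monotone sequence `d (u, z i)`, which is small on one of the first `B` blocks determined by
any counterfunction (`SphericallyConvex.resolvent_metastable`).

The iteration. Successive steps satisfy a contractive recursion with summable errors, so that
`χ_i` is a rate for `d (x n, T (x n)) → 0`
(`IsHalpernIteration.angDist_map_le_of_chi_le`). Consequently `x n` satisfies an approximate
variational inequality at `z i` (`SphericallyConvex.cos_anchor_le`), whose error is
`d (x n, T (x n))` divided by the parameter `1 / (i + 1)`: here the index `i = K₀` has to be fixed
beforehand. On the other hand, comparing `x (n + 1)` with a point `p` costs `d (p, T p)` at every
step (`SphericallyConvex.halpern_step`), so that `p` has to be a resolvent `z J` with `J` large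
compared with the number of steps. The two requirements are reconciled by metastability: the
counterfunction `f*` makes `z K₀` and `z J` as close as `ε₀`. The recursion for
`1 - cos d (x n, z J)` then has three errors, from the initial distance, the variational inequality
and the displacement of `z J`, each at most `(2 / 3) sin² (ε√κ / 4)`
(`IsHalpernIteration.one_sub_cos_le`), and `x n` is within `ε / 2` of `z J` on the whole interval.
-/

namespace Halpern

open Real

section

variable {X : Type*} [MetricSpace X]

/-! ### Geodesics and the spherical comparison inequality -/

theorem IsGeodesicPath.concat {x y z : X} {c₁ c₂ : ℝ → X} (h₁ : IsGeodesicPath c₁ x z)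
    (h₂ : IsGeodesicPath c₂ z y) (h : dist x z + dist z y = dist x y) :
    IsGeodesicPath (fun s => if s ≤ dist x z then c₁ s else c₂ (s - dist x z)) x y := by
  have hxz : 0 ≤ dist x z := dist_nonneg
  have hzy : 0 ≤ dist z y := dist_nonneg
  have key : ∀ s ∈ Set.Icc 0 (dist x y), ∀ t ∈ Set.Icc 0 (dist x y), s ≤ t →
      dist (if s ≤ dist x z then c₁ s else c₂ (s - dist x z))
        (if t ≤ dist x z then c₁ t else c₂ (t - dist x z)) = |s - t| := by
    rintro s ⟨hs0, hs1⟩ t ⟨ht0, ht1⟩ hst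
    split_ifs with h1 h2 h2
    · exact h₁.isometry s ⟨hs0, h1⟩ t ⟨ht0, h2⟩
    · push Not at h2
      have hts : t - dist x z ∈ Set.Icc 0 (dist z y) := ⟨by linarith, by linarith⟩
      have e1 := h₁.isometry s ⟨hs0, h1⟩ (dist x z) ⟨hxz, le_rfl⟩
      have e2 := h₂.isometry 0 ⟨le_rfl, hzy⟩ _ hts
      have e3 := h₁.isometry 0 ⟨le_rfl, hxz⟩ s ⟨hs0, h1⟩
      have e4 := h₂.isometry _ hts (dist z y) ⟨hzy, le_rfl⟩
      rw [h₁.target] at e1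
      rw [h₂.source] at e2
      rw [h₁.source] at e3
      rw [h₂.target] at e4
      rw [abs_of_nonpos (by linarith)] at e1 e2 e3 e4
      rw [abs_of_nonpos (by linarith)]
      have t1 := dist_triangle (c₁ s) z (c₂ (t - dist x z))
      have t2 := dist_triangle4 x (c₁ s) (c₂ (t - dist x z)) y
      linarith
    · exact absurd (hst.trans h2) h1
    · push Not at h1 h2
      rw [h₂.isometry _ ⟨by linarith, by linarith⟩ _ ⟨by linarith, by linarith⟩]
      congr 1
      ring
  refine ⟨by simpa using h₁.source, ?_, ?_⟩
  · split_ifs with h1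
    · have h0 : dist z y = 0 := by linarith
      have hzy' : z = y := dist_eq_zero.mp h0
      subst hzy'
      exact h₁.target
    · rw [← h, add_sub_cancel_left]
      exact h₂.target
  · intro s hs t ht
    rcases le_total s t with hst | hst
    · exact key s hs t ht hst
    · rw [dist_comm, abs_sub_comm]
      exact key t ht s hs hst

theorem IsConvexComb.dist_add_dist {t : ℝ} {x y z : X} (h : IsConvexComb t x y z) :
    dist x z + dist z y = dist x y := by
  rw [dist_comm x z, h.1, h.2]
  ring

theorem IsGeodesicPath.isConvexComb {x y : X} {c : ℝ → X} (hc : IsGeodesicPath c x y) {t : ℝ}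
    (ht : t ∈ Set.Icc (0 : ℝ) 1) : IsConvexComb t x y (c (t * dist x y)) := by
  have h0 : 0 ≤ dist x y := dist_nonneg
  have hm : t * dist x y ∈ Set.Icc 0 (dist x y) :=
    ⟨mul_nonneg ht.1 h0, mul_le_of_le_one_left h0 ht.2⟩
  have e1 := hc.isometry _ hm 0 ⟨le_rfl, h0⟩
  have e2 := hc.isometry _ hm _ ⟨h0, le_rfl⟩
  rw [hc.source, sub_zero, abs_of_nonneg hm.1] at e1
  rw [hc.target, abs_of_nonpos (by linarith [hm.2])] at e2
  exact ⟨e1, by rw [e2]; ring⟩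

/-- A point whose distances to `x` and `y` are those of a convex combination lies on a geodesic
from `x` to `y`: geodesics to and from it can be concatenated. -/
theorem IsConvexComb.exists_geodesic {κ : ℝ} (hX : IsCAT κ X) {t : ℝ} {x y z : X}
    (h : IsConvexComb t x y z) (hxy : dist x y < modelDiam κ) :
    ∃ c, IsGeodesicPath c x y ∧ c (t * dist x y) = z := by
  have hs := h.dist_add_dist
  have h1 : 0 ≤ dist x z := dist_nonneg
  have h2 : 0 ≤ dist z y := dist_nonneg
  obtain ⟨c₁, hc₁⟩ := hX.exists_geodesic x z (by linarith)
  obtain ⟨c₂, hc₂⟩ := hX.exists_geodesic z y (by linarith)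
  refine ⟨_, hc₁.concat hc₂ hs, ?_⟩
  have ht : t * dist x y = dist x z := by rw [dist_comm x z, h.1]
  simp only [ht, le_refl, if_true]
  exact hc₁.target

/-- The point of the model sphere with coordinates `a, b, c`. -/
def spherePoint (a b c : ℝ) (h : a ^ 2 + b ^ 2 + c ^ 2 = 1) : ModelSphere :=
  ⟨!₂[a, b, c], by
    rw [mem_sphere_zero_iff_norm, EuclideanSpace.norm_eq]
    simp [Fin.sum_univ_three, h]⟩

theorem inner_spherePoint (a b c a' b' c' : ℝ) (h h') :
    inner ℝ (spherePoint a b c h : EuclideanSpace ℝ (Fin 3)) (spherePoint a' b' c' h')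
      = a * a' + b * b' + c * c' := by
  simp [spherePoint, PiLp.inner_apply, Fin.sum_univ_three]
  ring

theorem modelDist_of_inner_eq_cos {κ : ℝ} (hκ : 0 < κ) {p q : ModelSphere} {r : ℝ}
    (h : inner ℝ (p : EuclideanSpace ℝ (Fin 3)) (q : EuclideanSpace ℝ (Fin 3)) = cos (√κ * r))
    (h0 : 0 ≤ r) (h1 : √κ * r ≤ π) : modelDist κ p q = r := by
  have hs : 0 < √κ := sqrt_pos.mpr hκ
  rw [modelDist, h, arccos_cos (by positivity) h1]
  field_simp

/-- Cosine form of the CAT(κ) inequality between a vertex of a triangle and a point of the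
opposite side: in the model sphere it is an equality, obtained by taking inner products of the
vertex with the spherical interpolation between the ends of the side. -/
theorem cos_dist_convexComb_ge {κ : ℝ} (hκ : 0 < κ) (hX : IsCAT κ X) {w x y z : X} {t : ℝ}
    (ht : t ∈ Set.Icc (0 : ℝ) 1) (hz : IsConvexComb t x y z)
    (hxy : √κ * dist x y < π / 2) (hwx : √κ * dist w x < π / 2) (hwy : √κ * dist w y < π / 2) :
    sin ((1 - t) * (√κ * dist x y)) * cos (√κ * dist w x)
      + sin (t * (√κ * dist x y)) * cos (√κ * dist w y)
      ≤ sin (√κ * dist x y) * cos (√κ * dist w z) := by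
  have hs : 0 < √κ := sqrt_pos.mpr hκ
  have hpi := pi_pos
  rcases (dist_nonneg : 0 ≤ dist x y).eq_or_lt with h0 | hpos
  · rw [← h0]; simp
  have hdiam : ∀ r : ℝ, √κ * r < π / 2 → r < modelDiam κ / 2 := by
    intro r hr
    rw [modelDiam, div_div, lt_div_iff₀ (by positivity)]
    linarith
  have hmd : 0 < modelDiam κ := div_pos hpi hs
  have d1 := hdiam _ hxy
  have d2 := hdiam _ hwx
  have d3 := hdiam _ hwy
  obtain ⟨c₀, hc₀, hc₀z⟩ := hz.exists_geodesic hX (by linarith)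
  obtain ⟨c₁, hc₁⟩ := hX.exists_geodesic y w (by rw [dist_comm]; linarith)
  obtain ⟨c₂, hc₂⟩ := hX.exists_geodesic w x (by linarith)
  set D := √κ * dist x y with hD
  set b := √κ * dist w x with hb
  set e := √κ * dist w y with he
  have hD0 : 0 < D := mul_pos hs hpos
  have hb0 : 0 ≤ b := mul_nonneg hs.le dist_nonneg
  have he0 : 0 ≤ e := mul_nonneg hs.le dist_nonneg
  have hsD : 0 < sin D := sin_pos_of_pos_of_lt_pi hD0 (by linarith)
  have hsb : 0 ≤ sin b := sin_nonneg_of_nonneg_of_le_pi hb0 (by linarith)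
  have tr1 : e ≤ b + D := by
    rw [he, hb, hD, ← mul_add]
    exact mul_le_mul_of_nonneg_left (dist_triangle w x y) hs.le
  have tr2 : b ≤ e + D := by
    rw [he, hb, hD, ← mul_add, dist_comm x y]
    exact mul_le_mul_of_nonneg_left (dist_triangle w y x) hs.le
  have tr3 : D ≤ b + e := by
    rw [he, hb, hD, ← mul_add, dist_comm w x]
    exact mul_le_mul_of_nonneg_left (dist_triangle x w y) hs.le
  have ce1 : cos e ≤ cos b * cos D + sin b * sin D := by
    rw [← cos_sub, ← cos_abs (b - D)]
    exact cos_le_cos_of_nonneg_of_le_pi (abs_nonneg _) (by linarith)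
      (abs_le.mpr ⟨by linarith, by linarith⟩)
  have ce2 : cos b * cos D - sin b * sin D ≤ cos e := by
    rw [← cos_add]
    exact cos_le_cos_of_nonneg_of_le_pi he0 (by linarith) tr1
  -- the second coordinate of the third vertex of the comparison triangle
  set v := (cos e - cos b * cos D) / sin D with hv
  have hvD : v * sin D = cos e - cos b * cos D := by rw [hv]; field_simp
  have hvb : v ^ 2 ≤ sin b ^ 2 := by
    apply sq_le_sq'
    · rw [hv, le_div_iff₀ hsD]; linarith
    · rw [hv, div_le_iff₀ hsD]; linarith
  let q₀ := spherePoint 1 0 0 (by norm_num)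
  let q₁ := spherePoint (cos D) (sin D) 0 (by nlinarith [sin_sq_add_cos_sq D])
  let q₂ := spherePoint (cos b) v (√(sin b ^ 2 - v ^ 2)) (by
    rw [sq_sqrt (by linarith)]; linarith [sin_sq_add_cos_sq b])
  let a := spherePoint (cos (t * D)) (sin (t * D)) 0
    (by nlinarith [sin_sq_add_cos_sq (t * D)])
  have m01 : modelDist κ q₀ q₁ = dist x y :=
    modelDist_of_inner_eq_cos hκ (by rw [inner_spherePoint, ← hD]; ring) dist_nonneg
      (by linarith)
  have m02 : modelDist κ q₀ q₂ = dist x w :=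
    modelDist_of_inner_eq_cos hκ (by rw [inner_spherePoint, dist_comm, ← hb]; ring) dist_nonneg
      (by rw [dist_comm]; linarith)
  have m12 : modelDist κ q₁ q₂ = dist y w :=
    modelDist_of_inner_eq_cos hκ
      (by rw [inner_spherePoint, dist_comm, ← he]; linarith) dist_nonneg
      (by rw [dist_comm]; linarith)
  have mself : ∀ q : ModelSphere, modelDist κ q q = 0 := by
    intro q
    simp [modelDist]
  have mcomm : ∀ p q : ModelSphere, modelDist κ p q = modelDist κ q p := by
    intro p q; rw [modelDist, modelDist, real_inner_comm]
  have hD' : (1 - t) * D ≤ π := by nlinarith [ht.1, ht.2]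
  have htD : t * D ≤ D := mul_le_of_le_one_left hD0.le ht.2
  have ma0 : modelDist κ a q₀ = t * dist x y :=
    modelDist_of_inner_eq_cos hκ (by
      rw [inner_spherePoint, show √κ * (t * dist x y) = t * D by rw [hD]; ring]; ring)
      (mul_nonneg ht.1 dist_nonneg)
      (by rw [show √κ * (t * dist x y) = t * D by rw [hD]; ring]; linarith)
  have ma1 : modelDist κ a q₁ = dist x y - t * dist x y :=
    modelDist_of_inner_eq_cos hκ (by
      rw [inner_spherePoint, show √κ * (dist x y - t * dist x y) = D - t * D by rw [hD]; ring,
        cos_sub]; ring)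
      (by nlinarith [ht.2])
      (by rw [show √κ * (dist x y - t * dist x y) = (1 - t) * D by rw [hD]; ring]; exact hD')
  have main := hX.comparison ![x, y, w] ![c₀, c₁, c₂]
    (by intro i; fin_cases i <;> assumption)
    (by simp only [Matrix.cons_val]; rw [dist_comm y w]; linarith)
    ![q₀, q₁, q₂]
    (by
      intro i j
      fin_cases i <;> fin_cases j <;> simp only [Fin.zero_eta, Fin.mk_one, Fin.reduceFinMk,
        Matrix.cons_val, dist_self, mself, m01, m02, m12, mcomm q₁ q₀, mcomm q₂ q₀, mcomm q₂ q₁]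
        <;> first | rfl | exact dist_comm _ _)
    0 2 (t * dist x y) ⟨mul_nonneg ht.1 dist_nonneg, mul_le_of_le_one_left dist_nonneg ht.2⟩
    0 ⟨le_rfl, dist_nonneg⟩ a q₂ ma0 ma1 (mself q₂)
    (by
      have : modelDist κ q₂ q₀ = dist w x - 0 := by rw [mcomm, m02, dist_comm, sub_zero]
      exact this)
  have main' : dist z w ≤ modelDist κ a q₂ := by
    have h2 : (![c₀, c₁, c₂] 2) 0 = w := hc₂.source
    have h1 : (![c₀, c₁, c₂] 0) (t * dist x y) = z := hc₀z
    rw [h1, h2] at main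
    exact main
  have hin : cos (arccos (inner ℝ (a : EuclideanSpace ℝ (Fin 3)) (q₂ : EuclideanSpace ℝ (Fin 3))))
      = inner ℝ (a : EuclideanSpace ℝ (Fin 3)) (q₂ : EuclideanSpace ℝ (Fin 3)) := by
    have na : ‖(a : EuclideanSpace ℝ (Fin 3))‖ = 1 := by simp
    have nq : ‖(q₂ : EuclideanSpace ℝ (Fin 3))‖ = 1 := by simp
    have := abs_real_inner_le_norm (a : EuclideanSpace ℝ (Fin 3)) q₂
    rw [na, nq, mul_one, abs_le] at this
    exact cos_arccos this.1 this.2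
  have hle : √κ * dist w z
      ≤ arccos (inner ℝ (a : EuclideanSpace ℝ (Fin 3)) (q₂ : EuclideanSpace ℝ (Fin 3))) := by
    rw [modelDist, le_div_iff₀ hs, dist_comm] at main'
    linarith
  have hcos := cos_le_cos_of_nonneg_of_le_pi (mul_nonneg hs.le dist_nonneg) (arccos_le_pi _) hle
  rw [hin, inner_spherePoint] at hcos
  have := mul_le_mul_of_nonneg_left hcos hsD.le
  refine le_trans (le_of_eq ?_) this
  rw [show (1 - t) * D = D - t * D by ring, sin_sub]
  linear_combination (-sin (t * D)) * hvD

/-! ### Sets with the spherical comparison inequality -/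

/-- The distance rescaled to curvature one. -/
noncomputable def angDist (κ : ℝ) (x y : X) : ℝ := √κ * dist x y

theorem angDist_comm (κ : ℝ) (x y : X) : angDist κ x y = angDist κ y x := by
  rw [angDist, angDist, dist_comm]

theorem angDist_nonneg (κ : ℝ) (x y : X) : 0 ≤ angDist κ x y :=
  mul_nonneg (sqrt_nonneg _) dist_nonneg

theorem angDist_triangle (κ : ℝ) (x y z : X) :
    angDist κ x z ≤ angDist κ x y + angDist κ y z := by
  rw [angDist, angDist, angDist, ← mul_add]
  exact mul_le_mul_of_nonneg_left (dist_triangle x y z) (sqrt_nonneg _)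

/-- What the Halpern iteration needs from a convex set `C` of a CAT(κ) space, of rescaled diameter
at most `m < π / 2`: convex combinations exist in `C`, with a second one on the same geodesic as a
given one, and they satisfy the comparison inequality in cosine form. -/
structure SphericallyConvex (κ m : ℝ) (C : Set X) : Prop where
  kappa_pos : 0 < κ
  lt_pi_div_two : m < π / 2
  angDist_le : ∀ x ∈ C, ∀ y ∈ C, angDist κ x y ≤ m
  mem : ∀ x ∈ C, ∀ y ∈ C, ∀ t ∈ Set.Icc (0 : ℝ) 1, ∀ z, IsConvexComb t x y z → z ∈ C
  exists_dist_eq : ∀ x ∈ C, ∀ y ∈ C, ∀ s ∈ Set.Icc (0 : ℝ) 1, ∀ t ∈ Set.Icc (0 : ℝ) 1, ∀ z,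
    IsConvexComb s x y z → ∃ z', IsConvexComb t x y z' ∧ dist z z' = |s - t| * dist x y
  cos_le : ∀ w ∈ C, ∀ x ∈ C, ∀ y ∈ C, ∀ t ∈ Set.Icc (0 : ℝ) 1, ∀ z, IsConvexComb t x y z →
    sin ((1 - t) * angDist κ x y) * cos (angDist κ w x) +
      sin (t * angDist κ x y) * cos (angDist κ w y) ≤ sin (angDist κ x y) * cos (angDist κ w z)

theorem sphericallyConvex_of_isCAT {κ M : ℝ} (hκ : 0 < κ) (hX : IsCAT κ X) {C : Set X}
    (hC : GeodesicConvex C) (hM : M < modelDiam κ / 2) (hdist : ∀ x ∈ C, ∀ y ∈ C, dist x y ≤ M) :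
    SphericallyConvex κ (M * √κ) C := by
  have hs : 0 < √κ := sqrt_pos.mpr hκ
  have hmd : 0 < modelDiam κ := div_pos pi_pos hs
  have hm : M * √κ < π / 2 := by
    rw [modelDiam, div_div, lt_div_iff₀ (by positivity)] at hM
    linarith
  have hle : ∀ x ∈ C, ∀ y ∈ C, angDist κ x y ≤ M * √κ := fun x hx y hy => by
    rw [angDist, mul_comm]
    exact mul_le_mul_of_nonneg_right (hdist x hx y hy) hs.le
  have hlt : ∀ x ∈ C, ∀ y ∈ C, dist x y < modelDiam κ := fun x hx y hy => by
    linarith [hdist x hx y hy]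
  refine ⟨hκ, hm, hle, ?_, ?_, ?_⟩
  · intro x hx y hy t ht z hz
    obtain ⟨c, hc, rfl⟩ := hz.exists_geodesic hX (hlt x hx y hy)
    exact hC x hx y hy c hc _
      ⟨mul_nonneg ht.1 dist_nonneg, mul_le_of_le_one_left dist_nonneg ht.2⟩
  · intro x hx y hy s hs' t ht z hz
    obtain ⟨c, hc, rfl⟩ := hz.exists_geodesic hX (hlt x hx y hy)
    refine ⟨_, hc.isConvexComb ht, ?_⟩
    rw [hc.isometry _ ⟨mul_nonneg hs'.1 dist_nonneg, mul_le_of_le_one_left dist_nonneg hs'.2⟩ _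
      ⟨mul_nonneg ht.1 dist_nonneg, mul_le_of_le_one_left dist_nonneg ht.2⟩, ← sub_mul, abs_mul,
      abs_of_nonneg (dist_nonneg : 0 ≤ dist x y)]
  · intro w hw x hx y hy t ht z hz
    exact cos_dist_convexComb_ge hκ hX ht hz ((hle x hx y hy).trans_lt hm)
      ((hle w hw x hx).trans_lt hm) ((hle w hw y hy).trans_lt hm)

theorem IsConvexComb.angDist_left {t : ℝ} {x y z : X} (κ : ℝ) (h : IsConvexComb t x y z) :
    angDist κ x z = t * angDist κ x y := by
  rw [angDist, angDist, dist_comm x z, h.1]; ring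

theorem IsConvexComb.angDist_right {t : ℝ} {x y z : X} (κ : ℝ) (h : IsConvexComb t x y z) :
    angDist κ z y = (1 - t) * angDist κ x y := by
  rw [angDist, angDist, h.2]; ring

theorem isConvexComb_zero (x y : X) : IsConvexComb 0 x y x := by
  simp [IsConvexComb]

section Trigonometry

theorem mul_sin_le_sin_mul {k v : ℝ} (hk : k ∈ Set.Icc (0 : ℝ) 1) (hv : v ∈ Set.Icc 0 π) :
    k * sin v ≤ sin (k * v) := by
  have := strictConcaveOn_sin_Icc.concaveOn.2 (x := v) hv (y := 0) ⟨le_rfl, pi_pos.le⟩ hk.1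
    (sub_nonneg.mpr hk.2) (by ring)
  simpa using this

theorem sin_mul_le {s a m : ℝ} (hs : s ∈ Set.Icc (0 : ℝ) 1) (ha : 0 ≤ a) (ham : a ≤ m)
    (hm : m ≤ π / 2) : sin (s * a) ≤ (1 - (1 - s) * cos m) * sin a := by
  have hpi := pi_pos
  have h1 : (1 - s) * sin a ≤ sin ((1 - s) * a) :=
    mul_sin_le_sin_mul ⟨by linarith [hs.2], by linarith [hs.1]⟩ ⟨ha, by linarith⟩
  have h2 : 0 ≤ sin a := sin_nonneg_of_nonneg_of_le_pi ha (by linarith)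
  have h3 : cos m ≤ cos a := cos_le_cos_of_nonneg_of_le_pi ha (by linarith) ham
  have h4 : 0 ≤ cos m := cos_nonneg_of_mem_Icc ⟨by linarith, hm⟩
  have h5 : sin (s * a) = sin a * cos ((1 - s) * a) - cos a * sin ((1 - s) * a) := by
    rw [← sin_sub]; congr 1; ring
  have h6 := mul_le_mul_of_nonneg_left (cos_le_one ((1 - s) * a)) h2
  have h7 := mul_le_mul_of_nonneg_left h1 (h4.trans h3)
  have h8 := mul_le_mul_of_nonneg_right h3 (mul_nonneg (sub_nonneg.mpr hs.2) h2)
  nlinarith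

theorem one_sub_cos_eq (v : ℝ) : 1 - cos v = 2 * sin (v / 2) ^ 2 := by
  rw [sin_sq_eq_half_sub]; ring_nf

theorem le_mul_of_one_sub_cos_le {k c c' : ℝ} (hk : k ∈ Set.Icc (0 : ℝ) 1)
    (hc : c ∈ Set.Icc 0 π) (hc' : c' ∈ Set.Icc 0 π)
    (h : 1 - cos c' ≤ k ^ 2 * (1 - cos c)) : c' ≤ k * c := by
  rw [one_sub_cos_eq, one_sub_cos_eq] at h
  have hpi := pi_pos
  have h0 : 0 ≤ sin (c / 2) := sin_nonneg_of_nonneg_of_le_pi (by linarith [hc.1]) (by linarith [hc.2])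
  have h1 : sin (c' / 2) ≤ k * sin (c / 2) :=
    le_of_sq_le_sq (by nlinarith) (mul_nonneg hk.1 h0)
  have h2 := h1.trans (mul_sin_le_sin_mul hk (v := c / 2) ⟨by linarith [hc.1], by linarith [hc.2]⟩)
  have hkc : k * c ≤ c := mul_le_of_le_one_left hc.1 hk.2
  have hkc0 : 0 ≤ k * c := mul_nonneg hk.1 hc.1
  have h3 := (strictMonoOn_sin.le_iff_le (a := c' / 2) (b := k * (c / 2))
    ⟨by linarith [hc'.1], by linarith [hc'.2]⟩ ⟨by linarith, by linarith [hc.2]⟩).mp h2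
  linarith

end Trigonometry

namespace SphericallyConvex

variable {κ m : ℝ} {C : Set X}

theorem cos_pos (hC : SphericallyConvex κ m C) (hm : 0 ≤ m) : 0 < cos m :=
  cos_pos_of_mem_Ioo ⟨by linarith [pi_pos], hC.lt_pi_div_two⟩

theorem eq_of_angDist_eq_zero (hC : SphericallyConvex κ m C) {x y : X} (h : angDist κ x y = 0) :
    x = y := by
  rcases mul_eq_zero.mp h with h | h
  · exact absurd h (sqrt_pos.mpr hC.kappa_pos).ne'
  · exact dist_eq_zero.mp h

theorem exists_convexComb (hC : SphericallyConvex κ m C) {x y : X} (hx : x ∈ C) (hy : y ∈ C)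
    {t : ℝ} (ht : t ∈ Set.Icc (0 : ℝ) 1) : ∃ z ∈ C, IsConvexComb t x y z := by
  obtain ⟨z, hz, -⟩ := hC.exists_dist_eq x hx y hy 0 ⟨le_rfl, zero_le_one⟩ t ht x
    (isConvexComb_zero x y)
  exact ⟨z, hC.mem x hx y hy t ht z hz, hz⟩

/-- Comparison of two geodesics issuing from `u`: by the spherical law of cosines, the inequality
says that the comparison angle at `u` does not grow when `x` and `y` are replaced by points `x'` and
`y'` closer to `u`. -/
theorem cos_comparison (hC : SphericallyConvex κ m C) {u x y x' y' : X} (hu : u ∈ C) (hx : x ∈ C)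
    (hy : y ∈ C) {s t : ℝ} (hs : s ∈ Set.Icc (0 : ℝ) 1) (ht : t ∈ Set.Icc (0 : ℝ) 1)
    (hx' : IsConvexComb s u x x') (hy' : IsConvexComb t u y y') :
    sin (angDist κ u x') * sin (angDist κ u y')
        * (cos (angDist κ x y) - cos (angDist κ u x) * cos (angDist κ u y))
      ≤ sin (angDist κ u x) * sin (angDist κ u y)
        * (cos (angDist κ x' y') - cos (angDist κ u x') * cos (angDist κ u y')) := by
  have hpi := pi_pos
  have mx' := hC.mem u hu x hx s hs x' hx'
  have h1 := hC.cos_le y hy u hu x hx s hs x' hx'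
  have h2 := hC.cos_le x' mx' u hu y hy t ht y' hy'
  have ha := hx'.angDist_left κ
  have hb := hy'.angDist_left κ
  rw [sub_mul, one_mul, ← ha, sin_sub, angDist_comm κ y u, angDist_comm κ y x,
    angDist_comm κ y x'] at h1
  rw [sub_mul, one_mul, ← hb, sin_sub, angDist_comm κ x' u] at h2
  have nn : ∀ p ∈ C, ∀ q ∈ C, 0 ≤ sin (angDist κ p q) := fun p hp q hq =>
    sin_nonneg_of_nonneg_of_le_pi (angDist_nonneg _ _ _)
      (by linarith [hC.angDist_le p hp q hq, hC.lt_pi_div_two])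
  have my' := hC.mem u hu y hy t ht y' hy'
  have h3 := mul_le_mul_of_nonneg_left h1 (nn u hu y' my')
  have h4 := mul_le_mul_of_nonneg_left h2 (nn u hu x hx)
  linarith

/-- The inequality `cos_comparison`, expressed through the differences to the degenerate triangles
with angle `0` at `u`. -/
theorem cos_comparison' (hC : SphericallyConvex κ m C) {u x y x' y' : X} (hu : u ∈ C) (hx : x ∈ C)
    (hy : y ∈ C) {s t : ℝ} (hs : s ∈ Set.Icc (0 : ℝ) 1) (ht : t ∈ Set.Icc (0 : ℝ) 1)
    (hx' : IsConvexComb s u x x') (hy' : IsConvexComb t u y y') :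
    sin (angDist κ u x) * sin (angDist κ u y)
        * (cos (angDist κ u x' - angDist κ u y') - cos (angDist κ x' y'))
      ≤ sin (angDist κ u x') * sin (angDist κ u y')
        * (cos (angDist κ u x - angDist κ u y) - cos (angDist κ x y)) := by
  have := hC.cos_comparison hu hx hy hs ht hx' hy'
  rw [cos_sub, cos_sub]
  linarith

theorem cos_angDist_le_cos_sub (hC : SphericallyConvex κ m C) {u x y : X} (hx : x ∈ C)
    (hy : y ∈ C) : cos (angDist κ x y) ≤ cos (angDist κ u x - angDist κ u y) := by
  rw [← cos_abs (angDist κ u x - angDist κ u y)]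
  refine cos_le_cos_of_nonneg_of_le_pi (abs_nonneg _)
    (by linarith [hC.angDist_le x hx y hy, hC.lt_pi_div_two, pi_pos]) ?_
  have h1 := angDist_triangle κ u x y
  have h2 := angDist_triangle κ u y x
  rw [angDist_comm κ y x] at h2
  exact abs_le.mpr ⟨by linarith, by linarith⟩

/-- Moving two points towards `u` by the same ratio is a strict contraction. -/
theorem angDist_convexComb_le (hC : SphericallyConvex κ m C) {u x y x' y' : X} (hu : u ∈ C)
    (hx : x ∈ C) (hy : y ∈ C) {s : ℝ} (hs : s ∈ Set.Icc (0 : ℝ) 1)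
    (hx' : IsConvexComb s u x x') (hy' : IsConvexComb s u y y') :
    angDist κ x' y' ≤ (1 - (1 - s) * cos m) * angDist κ x y := by
  have hpi := pi_pos
  have hm2 := hC.lt_pi_div_two
  have ha := hx'.angDist_left κ
  have hb := hy'.angDist_left κ
  have a0 := angDist_nonneg κ u x
  have b0 := angDist_nonneg κ u y
  have am := hC.angDist_le u hu x hx
  have bm := hC.angDist_le u hu y hy
  have hcm := (hC.cos_pos (a0.trans am)).le
  have hk1 : (1 - s) * cos m ≤ 1 - s :=
    mul_le_of_le_one_right (sub_nonneg.mpr hs.2) (cos_le_one m)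
  have hk2 : 0 ≤ (1 - s) * cos m := mul_nonneg (sub_nonneg.mpr hs.2) hcm
  have hdeg : ∀ x y x' y' : X, IsConvexComb s u x x' → IsConvexComb s u y y' →
      angDist κ u x = 0 → angDist κ x' y' ≤ (1 - (1 - s) * cos m) * angDist κ x y := by
    intro x y x' y' hx' hy' h0
    have hux := hC.eq_of_angDist_eq_zero h0
    have hux' : x' = u := by
      have := hx'.1
      rw [← hux, dist_self, mul_zero] at this
      exact dist_eq_zero.mp this
    rw [hux', ← hux, hy'.angDist_left κ]
    exact mul_le_mul_of_nonneg_right (by linarith) (angDist_nonneg _ _ _)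
  rcases a0.eq_or_lt with h0 | apos
  · exact hdeg x y x' y' hx' hy' h0.symm
  rcases b0.eq_or_lt with h0 | bpos
  · rw [angDist_comm κ x' y', angDist_comm κ x y]
    exact hdeg y x y' x' hy' hx' h0.symm
  have mx' := hC.mem u hu x hx s hs x' hx'
  have my' := hC.mem u hu y hy s hs y' hy'
  have hcomp := hC.cos_comparison' hu hx hy hs hs hx' hy'
  have hcc := hC.cos_angDist_le_cos_sub (u := u) hx hy
  have hsa := sin_mul_le hs a0 am hm2.le
  have hsb := sin_mul_le hs b0 bm hm2.le
  set k := 1 - (1 - s) * cos m with hk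
  rw [ha, hb] at hcomp
  set a := angDist κ u x
  set b := angDist κ u y
  have psa : 0 < sin a := sin_pos_of_pos_of_lt_pi apos (by linarith)
  have psb : 0 < sin b := sin_pos_of_pos_of_lt_pi bpos (by linarith)
  have hk0 : 0 ≤ k := by linarith [hs.1]
  have nsb : 0 ≤ sin (s * b) := sin_nonneg_of_nonneg_of_le_pi (mul_nonneg hs.1 b0)
    (by linarith [mul_le_of_le_one_left b0 hs.2])
  have hprod : sin (s * a) * sin (s * b) ≤ k * sin a * (k * sin b) :=
    mul_le_mul hsa hsb nsb (mul_nonneg hk0 psa.le)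
  -- the radial part of the distance
  have hrad : 1 - cos (s * a - s * b) ≤ k ^ 2 * (1 - cos (a - b)) := by
    rw [← mul_sub, ← cos_abs, ← cos_abs (a - b), abs_mul, abs_of_nonneg hs.1, one_sub_cos_eq,
      one_sub_cos_eq]
    have hab : |a - b| ≤ m := abs_le.mpr ⟨by linarith, by linarith⟩
    have h1 := sin_mul_le (a := |a - b| / 2) hs (by positivity)
      (by linarith [abs_nonneg (a - b)]) hm2.le
    have h2 : 0 ≤ sin (s * (|a - b| / 2)) :=
      sin_nonneg_of_nonneg_of_le_pi (mul_nonneg hs.1 (by positivity))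
        (by nlinarith [abs_nonneg (a - b), hs.1, hs.2])
    have h3 := mul_self_le_mul_self h2 h1
    rw [mul_div_assoc]
    nlinarith
  have hfin : 1 - cos (angDist κ x' y') ≤ k ^ 2 * (1 - cos (angDist κ x y)) := by
    have h1 := hcomp.trans (mul_le_mul_of_nonneg_right hprod (sub_nonneg.mpr hcc))
    have h2 : sin a * sin b * (cos (s * a - s * b) - cos (angDist κ x' y'))
        ≤ sin a * sin b * (k ^ 2 * (cos (a - b) - cos (angDist κ x y))) := by
      linarith
    have h3 := le_of_mul_le_mul_left h2 (mul_pos psa psb)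
    linarith
  exact le_mul_of_one_sub_cos_le ⟨hk0, by linarith⟩
    ⟨angDist_nonneg _ _ _, by linarith [hC.angDist_le x hx y hy]⟩
    ⟨angDist_nonneg _ _ _, by linarith [hC.angDist_le x' mx' y' my']⟩ hfin

end SphericallyConvex

/-! ### Resolvents of a nonexpansive mapping -/

/-- `z = t u + (1 - t) T z`. -/
def IsResolvent (T : X → X) (u : X) (t : ℝ) (z : X) : Prop :=
  IsConvexComb (1 - t) u (T z) z

theorem angDist_map_le (κ : ℝ) {C : Set X} {T : X → X}
    (hT : ∀ x ∈ C, ∀ y ∈ C, dist (T x) (T y) ≤ dist x y) {x y : X} (hx : x ∈ C) (hy : y ∈ C) :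
    angDist κ (T x) (T y) ≤ angDist κ x y :=
  mul_le_mul_of_nonneg_left (hT x hx y hy) (sqrt_nonneg _)

section Trigonometry

/-- The trigonometric core of the monotonicity of resolvents. Here `a ≤ A` and `b ≤ A'` are the
distances from `u` of `z, T z` and of `w, T w`, for the resolvents `z, w` with parameters `s ≥ t`,
and `q` is the cosine of the distance of `z` and `w`; the hypothesis `h` is the comparison
inequality after replacing the distance of `T z` and `T w` by that of `z` and `w`. It forces
`|A - A'| ≤ |a - b|`, and this gives both conclusions. -/
theorem resolvent_trig {a b A A' q s t m : ℝ} (hm : m < π / 2) (hA0 : 0 ≤ A) (hAm : A ≤ m)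
    (hA'0 : 0 ≤ A') (hA'm : A' ≤ m)
    (ha : 0 < a) (hb : 0 < b) (ht : 0 < t) (hts : t ≤ s)
    (haA : a = (1 - s) * A) (hbA : b = (1 - t) * A') (hq : q ≤ cos (a - b))
    (h : sin A * sin A' * (cos (a - b) - q) ≤ sin a * sin b * (cos (A - A') - q)) :
    a ≤ b ∧ cos b ≤ q * cos a := by
  have hpi := pi_pos
  have haA1 : a < A := by
    nlinarith [hA0.lt_of_ne fun h0 => ha.ne' (by rw [haA, ← h0, mul_zero])]
  have hbA1 : b < A' := by
    nlinarith [hA'0.lt_of_ne fun h0 => hb.ne' (by rw [hbA, ← h0, mul_zero])]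
  have sa : 0 < sin a := sin_pos_of_pos_of_lt_pi ha (by linarith)
  have sb : 0 < sin b := sin_pos_of_pos_of_lt_pi hb (by linarith)
  have saA : sin a < sin A := sin_lt_sin_of_lt_of_le_pi_div_two (by linarith) (by linarith) haA1
  have sbA : sin b < sin A' := sin_lt_sin_of_lt_of_le_pi_div_two (by linarith) (by linarith) hbA1
  have hprod : sin a * sin b < sin A * sin A' := mul_lt_mul'' saA sbA sa.le sb.le
  have hcos : cos (a - b) ≤ cos (A - A') := by
    by_contra! hlt
    have h1 := mul_lt_mul_of_pos_left (sub_lt_sub_right hlt q) (mul_pos sa sb)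
    have h2 := mul_le_mul_of_nonneg_right hprod.le (sub_nonneg.mpr hq)
    linarith
  have habs : |A - A'| ≤ |a - b| := by
    by_contra! hlt
    have := cos_lt_cos_of_nonneg_of_le_pi (abs_nonneg (a - b))
      (abs_le.mpr ⟨by linarith, by linarith⟩) hlt
    rw [cos_abs, cos_abs] at this
    linarith
  have hab : a ≤ b := by
    by_contra! hlt
    rw [abs_of_pos (sub_pos.mpr hlt)] at habs
    have h1 := (abs_le.mp habs).2
    have h2 : s * A ≤ t * A' := by nlinarith
    have hA : 0 < A := ha.trans haA1
    have ht1 : 0 < 1 - t := by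
      by_contra! hle
      nlinarith [hb.trans hbA1]
    have h3 : (1 - t) * A' < (1 - t) * A := by nlinarith
    have h4 : A' < A := lt_of_mul_lt_mul_left h3 ht1.le
    nlinarith
  refine ⟨hab, ?_⟩
  rw [abs_sub_comm a b, abs_of_nonneg (sub_nonneg.mpr hab), abs_le] at habs
  have hfirst : cos (A - a) ≤ cos (A' - b) :=
    cos_le_cos_of_nonneg_of_le_pi (by linarith) (by linarith) (by linarith [habs.1])
  have hsecond : sin a * sin A ≤ sin b * sin A' := by
    have h1 : cos (A' + b) ≤ cos (A + a) :=
      cos_le_cos_of_nonneg_of_le_pi (by linarith) (by linarith) (by linarith [habs.2])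
    rw [cos_add, cos_add] at h1
    rw [cos_sub, cos_sub] at hfirst
    linarith
  have cA' : 0 ≤ cos A' := cos_nonneg_of_mem_Icc ⟨by linarith, by linarith⟩
  have ca : 0 ≤ cos a := cos_nonneg_of_mem_Icc ⟨by linarith, by linarith⟩
  have sd : 0 ≤ sin (A' - b) := sin_nonneg_of_nonneg_of_le_pi (by linarith) (by linarith)
  -- `cos a` times the left side of `hlow` exceeds `(sin A * sin A' - sin a * sin b) * cos b` by
  -- `sin a` times the right side of `hG'`, which `hG'` splits into two parts of known sign
  have hG : 0 ≤ sin b * cos A' * (cos (A' - b) - cos (A - a))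
      + sin (A' - b) * (sin b * sin A' - sin a * sin A) :=
    add_nonneg (mul_nonneg (mul_nonneg sb.le cA') (sub_nonneg.mpr hfirst))
      (mul_nonneg sd (sub_nonneg.mpr hsecond))
  have hG' : sin b * cos A' * (cos (A' - b) - cos (A - a))
      + sin (A' - b) * (sin b * sin A' - sin a * sin A)
      = sin b * cos b - sin b * cos a * cos A * cos A' - sin a * sin A * sin A' * cos b := by
    rw [cos_sub, cos_sub, sin_sub]
    linear_combination (sin b * cos b) * (sin_sq_add_cos_sq A')
  rw [hG'] at hG
  have hlow : sin A * sin A' * cos a * cos b - sin a * sin b * cos A * cos A'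
      ≤ (sin A * sin A' - sin a * sin b) * q := by
    rw [cos_sub, cos_sub] at h
    linarith
  have h1 := mul_le_mul_of_nonneg_left hlow ca
  have h2 := mul_nonneg sa.le hG
  have h3 : (sin A * sin A' - sin a * sin b) * cos b
      ≤ (sin A * sin A' - sin a * sin b) * (q * cos a) := by
    have h4 : cos a * (sin A * sin A' * cos a * cos b - sin a * sin b * cos A * cos A')
        - (sin A * sin A' - sin a * sin b) * cos b
        = sin a * (sin b * cos b - sin b * cos a * cos A * cos A'
          - sin a * sin A * sin A' * cos b) := by
      linear_combination (sin A * sin A' * cos b) * (sin_sq_add_cos_sq a)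
    linarith
  exact le_of_mul_le_mul_left h3 (sub_pos.mpr hprod)

end Trigonometry

namespace SphericallyConvex

variable {κ m : ℝ} {C : Set X} {T : X → X} {u : X}

theorem exists_isResolvent [CompleteSpace X] (hC : SphericallyConvex κ m C) (hm : 0 ≤ m)
    (hclosed : IsClosed C)
    (hTC : Set.MapsTo T C C) (hT : ∀ x ∈ C, ∀ y ∈ C, dist (T x) (T y) ≤ dist x y) (hu : u ∈ C)
    {t : ℝ} (ht : t ∈ Set.Ioc (0 : ℝ) 1) : ∃ z ∈ C, IsResolvent T u t z := by
  have ht' : 1 - t ∈ Set.Icc (0 : ℝ) 1 := ⟨by linarith [ht.2], by linarith [ht.1]⟩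
  choose F hFC hF using fun v : C => hC.exists_convexComb hu (hTC v.2) ht'
  have hcm := hC.cos_pos hm
  have : CompleteSpace C := hclosed.completeSpace_coe
  have : Nonempty C := ⟨⟨u, hu⟩⟩
  let G : C → C := fun v => ⟨F v, hFC v⟩
  have hk : 0 ≤ 1 - t * cos m := by nlinarith [cos_le_one m, ht.1, ht.2]
  have hG : ContractingWith (1 - t * cos m).toNNReal G := by
    refine ⟨?_, LipschitzWith.of_dist_le_mul fun v w => ?_⟩
    · rw [toNNReal_lt_one]
      linarith [mul_pos ht.1 hcm]
    · rw [coe_toNNReal _ hk]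
      change dist (F v) (F w) ≤ (1 - t * cos m) * dist (v : X) w
      have h1 := hC.angDist_convexComb_le hu (hTC v.2) (hTC w.2) ht' (hF v) (hF w)
      rw [sub_sub_cancel, angDist, angDist, mul_left_comm] at h1
      have h2 := le_of_mul_le_mul_left h1 (sqrt_pos.mpr hC.kappa_pos)
      exact h2.trans (mul_le_mul_of_nonneg_left (hT v v.2 w w.2) hk)
  refine ⟨hG.fixedPoint, (hG.fixedPoint).2, ?_⟩
  have h1 : (G hG.fixedPoint : X) = hG.fixedPoint := congrArg Subtype.val hG.fixedPoint_isFixedPt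
  have h2 := hF hG.fixedPoint
  rw [show F hG.fixedPoint = hG.fixedPoint from h1] at h2
  exact h2

/-- As the weight of the anchor `u` decreases, the resolvent moves away from `u`, and the angle at
the earlier resolvent between `u` and the later one is at least `π / 2`. -/
theorem resolvent_mono (hC : SphericallyConvex κ m C)
    (hTC : Set.MapsTo T C C) (hT : ∀ x ∈ C, ∀ y ∈ C, dist (T x) (T y) ≤ dist x y) (hu : u ∈ C)
    {s t : ℝ} (ht : 0 < t) (hts : t ≤ s) (hs : s ≤ 1) {z w : X} (hz : z ∈ C) (hw : w ∈ C)
    (hzr : IsResolvent T u s z) (hwr : IsResolvent T u t w) :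
    angDist κ u z ≤ angDist κ u w ∧
      cos (angDist κ u w) ≤ cos (angDist κ z w) * cos (angDist κ u z) := by
  have hpi := pi_pos
  have hm2 := hC.lt_pi_div_two
  have haA := IsConvexComb.angDist_left κ hzr
  have hbA := IsConvexComb.angDist_left κ hwr
  rcases (angDist_nonneg κ u z).eq_or_lt with h0 | ha
  · have huz := hC.eq_of_angDist_eq_zero h0.symm
    rw [← h0, ← huz, cos_zero, mul_one]
    exact ⟨angDist_nonneg _ _ _, le_rfl⟩
  rcases (angDist_nonneg κ u w).eq_or_lt with h0 | hb
  · exfalso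
    have huw := hC.eq_of_angDist_eq_zero h0.symm
    have hTu : u = T u := by
      rcases mul_eq_zero.mp (h0.trans hbA).symm with h1 | h1
      · -- `t = 1`, hence `s = 1` and `z = u`
        have hs1 : 1 - s = 0 := by linarith
        rw [haA, hs1, zero_mul] at ha
        exact absurd ha (lt_irrefl _)
      · rw [← huw] at h1
        exact hC.eq_of_angDist_eq_zero h1
    have h1 := angDist_map_le κ hT hu hz
    rw [← hTu] at h1
    nlinarith
  have h1 := hC.cos_comparison' hu (hTC hz) (hTC hw) ⟨by linarith, by linarith⟩
    ⟨by linarith, by linarith⟩ hzr hwr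
  have h2 : cos (angDist κ z w) ≤ cos (angDist κ (T z) (T w)) :=
    cos_le_cos_of_nonneg_of_le_pi (angDist_nonneg _ _ _)
      (by linarith [hC.angDist_le z hz w hw]) (angDist_map_le κ hT hz hw)
  have nn : ∀ p ∈ C, ∀ q ∈ C, 0 ≤ sin (angDist κ p q) := fun p hp q hq =>
    sin_nonneg_of_nonneg_of_le_pi (angDist_nonneg _ _ _)
      (by linarith [hC.angDist_le p hp q hq])
  refine resolvent_trig hm2 (angDist_nonneg _ _ _) (hC.angDist_le u hu _ (hTC hz))
    (angDist_nonneg _ _ _) (hC.angDist_le u hu _ (hTC hw)) ha hb ht hts haA hbA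
    (hC.cos_angDist_le_cos_sub hz hw) (h1.trans ?_)
  exact mul_le_mul_of_nonneg_left (sub_le_sub_left h2 _) (mul_nonneg (nn u hu z hz) (nn u hu w hw))

end SphericallyConvex

/-! ### Metastability of the resolvents -/

theorem exists_iterate_increment_le {r : ℕ → ℝ} {m : ℝ} (h0 : 0 ≤ r 0) (hm : ∀ n, r n ≤ m)
    (F : ℕ → ℕ) (N : ℕ) (hN : 0 < N) :
    ∃ l < N, r (F (F^[l] 0)) - r (F^[l] 0) ≤ m / N := by
  by_contra! hlt
  have h1 : ∀ k ≤ N, k * (m / N) ≤ r (F^[k] 0) - r 0 := by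
    intro k
    induction k with
    | zero => intro _; simp
    | succ k ih =>
      intro hk
      have h2 := ih (by omega)
      have h3 := hlt k (by omega)
      rw [Function.iterate_succ_apply']
      push_cast
      linarith
  have hNR : (0 : ℝ) < N := by exact_mod_cast hN
  obtain ⟨K, rfl⟩ : ∃ K, N = K + 1 := ⟨N - 1, by omega⟩
  have h2 := h1 K (by omega)
  have h3 := hlt K (by omega)
  have h4 := hm (F (F^[K] 0))
  have h5 : ((K : ℝ) + 1) * (m / (K + 1)) = m := by field_simp
  push_cast at h3 h2
  linarith

/-- The distance of two resolvents is controlled by the increment of the distance from `u`. -/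
theorem SphericallyConvex.one_sub_cos_resolvent_le {κ m : ℝ} {C : Set X} {u z w : X}
    (hC : SphericallyConvex κ m C) (hu : u ∈ C) (hz : z ∈ C) (hw : w ∈ C)
    (hle : angDist κ u z ≤ angDist κ u w)
    (h : cos (angDist κ u w) ≤ cos (angDist κ z w) * cos (angDist κ u z)) :
    1 - cos (angDist κ z w) ≤ tan m * (angDist κ u w - angDist κ u z) := by
  have hpi := pi_pos
  have hm2 := hC.lt_pi_div_two
  have ha := angDist_nonneg κ u z
  have ham := hC.angDist_le u hu z hz
  have hbm := hC.angDist_le u hu w hw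
  set a := angDist κ u z
  set b := angDist κ u w
  have hcm := hC.cos_pos (ha.trans ham)
  have hca : cos m ≤ cos a := cos_le_cos_of_nonneg_of_le_pi ha (by linarith) ham
  have hsm : sin ((a + b) / 2) ≤ sin m :=
    sin_le_sin_of_le_of_le_pi_div_two (by linarith) (by linarith) (by linarith)
  have hs0 : 0 ≤ sin m := sin_nonneg_of_nonneg_of_le_pi (by linarith) (by linarith)
  have h1 : cos a - cos b ≤ sin m * (b - a) := by
    rw [cos_sub_cos, show (a - b) / 2 = -((b - a) / 2) by ring, sin_neg]
    have h2 : sin ((b - a) / 2) ≤ (b - a) / 2 := sin_le (by linarith)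
    have h3 : 0 ≤ sin ((b - a) / 2) :=
      sin_nonneg_of_nonneg_of_le_pi (by linarith) (by linarith)
    have h4 := mul_le_mul hsm h2 h3 hs0
    linarith
  rw [tan_eq_sin_div_cos, div_mul_eq_mul_div, le_div_iff₀ hcm]
  have h5 : 0 ≤ 1 - cos (angDist κ z w) := by linarith [cos_le_one (angDist κ z w)]
  have h6 := mul_le_mul_of_nonneg_left hca h5
  linarith

/-- Metastability of a sequence of resolvents with parameters `1 / (i + 1)`. -/
theorem SphericallyConvex.resolvent_metastable {κ m : ℝ} {C : Set X} {T : X → X} {u : X}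
    (hC : SphericallyConvex κ m C) (hm : 0 < m)
    (hTC : Set.MapsTo T C C) (hT : ∀ x ∈ C, ∀ y ∈ C, dist (T x) (T y) ≤ dist x y) (hu : u ∈ C)
    {z : ℕ → X} (hz : ∀ i, z i ∈ C) (hzr : ∀ i : ℕ, IsResolvent T u (1 / ((i : ℝ) + 1)) (z i))
    {η : ℝ} (hη : 0 < η) (hηπ : η ≤ π) (F : ℕ → ℕ) (hF : ∀ i, i ≤ F i) :
    ∃ K ≤ F^[⌈m * tan m / (1 - cos η)⌉₊] 0,
      ∀ i j, K ≤ i → i ≤ j → j ≤ F K →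
        angDist κ (z i) (z j) ≤ η ∧ angDist κ u (z i) ≤ angDist κ u (z j) := by
  have hpi := pi_pos
  have htan : 0 < tan m := tan_pos_of_pos_of_lt_pi_div_two hm hC.lt_pi_div_two
  have hcη : 0 < 1 - cos η := by
    have := cos_lt_cos_of_nonneg_of_le_pi le_rfl hηπ hη
    rw [cos_zero] at this
    linarith
  have hstep : ∀ i j, i ≤ j → angDist κ u (z i) ≤ angDist κ u (z j) ∧
      cos (angDist κ u (z j)) ≤ cos (angDist κ (z i) (z j)) * cos (angDist κ u (z i)) := by
    intro i j hij
    have hij' : (i : ℝ) ≤ j := by exact_mod_cast hij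
    refine hC.resolvent_mono hTC hT hu (by positivity)
      (one_div_le_one_div_of_le (by positivity) (by linarith)) ?_ (hz i) (hz j) (hzr i) (hzr j)
    rw [div_le_one (by positivity)]
    linarith [(Nat.cast_nonneg i : (0 : ℝ) ≤ i)]
  have hquot : 0 < m * tan m / (1 - cos η) := by positivity
  obtain ⟨l, hl, hinc⟩ := exists_iterate_increment_le (r := fun i => angDist κ u (z i))
    (angDist_nonneg _ _ _) (fun n => hC.angDist_le u hu _ (hz n)) F _ (Nat.ceil_pos.mpr hquot)
  set N := ⌈m * tan m / (1 - cos η)⌉₊ with hN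
  have hNR : m * tan m / (1 - cos η) ≤ N := Nat.le_ceil _
  have hmono : Monotone fun k => F^[k] 0 :=
    monotone_nat_of_le_succ fun k => by rw [Function.iterate_succ_apply']; exact hF _
  refine ⟨F^[l] 0, hmono hl.le, fun i j hi hij hj => ⟨?_, (hstep i j hij).1⟩⟩
  have h1 := hC.one_sub_cos_resolvent_le hu (hz i) (hz j) (hstep i j hij).1 (hstep i j hij).2
  have h2 := (hstep _ i hi).1
  have h3 := (hstep j _ hj).1
  have h4 : angDist κ u (z j) - angDist κ u (z i) ≤ m / N := by linarith
  have h5 : tan m * (m / N) ≤ 1 - cos η := by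
    have hNpos : (0 : ℝ) < N := hquot.trans_le hNR
    rw [div_le_iff₀ hcη] at hNR
    rw [mul_div_assoc', div_le_iff₀ hNpos]
    linarith
  have h6 := mul_le_mul_of_nonneg_left h4 htan.le
  by_contra! hlt
  have := cos_lt_cos_of_nonneg_of_le_pi hη.le
    (by linarith [hC.angDist_le _ (hz i) _ (hz j), hC.lt_pi_div_two]) hlt
  linarith

/-! ### Recursive inequalities and divergent sums -/

theorem le_exp_neg_sum_mul_add_sum {a c τ : ℕ → ℝ} (ha : ∀ n, 0 ≤ a n) (hc : ∀ n, c n ≤ 1)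
    (hc0 : ∀ n, 0 ≤ c n) (hτ : ∀ n, 0 ≤ τ n) (h : ∀ n, a (n + 1) ≤ (1 - c n) * a n + τ n)
    (k : ℕ) :
    a k ≤ exp (-∑ i ∈ Finset.range k, c i) * a 0 + ∑ i ∈ Finset.range k, τ i := by
  induction k with
  | zero => simp
  | succ k ih =>
    rw [Finset.sum_range_succ, Finset.sum_range_succ, neg_add, exp_add]
    have h1 : 1 - c k ≤ exp (-c k) := by linarith [add_one_le_exp (-c k)]
    have h2 := mul_le_mul_of_nonneg_left ih (sub_nonneg.mpr (hc k))
    have h3 := mul_le_mul_of_nonneg_right h1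
      (mul_nonneg (exp_nonneg (-∑ i ∈ Finset.range k, c i)) (ha 0))
    have h4 : (1 - c k) * ∑ i ∈ Finset.range k, τ i ≤ ∑ i ∈ Finset.range k, τ i :=
      mul_le_of_le_one_left (Finset.sum_nonneg fun i _ => hτ i) (by linarith [hc0 k])
    have h5 := h k
    linarith

theorem sum_Icc_add_eq_sum_range (h : ℕ → ℝ) (p k : ℕ) :
    ∑ i ∈ Finset.Icc (p + 1) (p + k), h i = ∑ i ∈ Finset.range k, h (p + 1 + i) := by
  rw [← Finset.Ico_add_one_right_eq_Icc, Finset.sum_Ico_eq_sum_range]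
  congr 2
  omega

section Divergence

variable {lam : ℕ → ℝ} {α γ : ℝ → ℕ} {θ : ℕ → ℕ}

theorem RateConditions.le_theta (hr : RateConditions lam α γ θ)
    (hlam : ∀ n, 1 ≤ n → lam n ∈ Set.Icc (0 : ℝ) 1) {n : ℕ} (hn : 1 ≤ n) : n ≤ θ n := by
  have h1 : ∑ k ∈ Finset.Icc 1 (θ n), lam (k + 1) ≤ ∑ k ∈ Finset.Icc 1 (θ n), (1 : ℝ) :=
    Finset.sum_le_sum fun k _ => (hlam (k + 1) (by omega)).2
  have h2 := (hr.diverges n hn).trans h1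
  simp only [Finset.sum_const, Nat.card_Icc, add_tsub_cancel_right, nsmul_eq_mul, mul_one] at h2
  exact_mod_cast h2

theorem RateConditions.sub_le_sum (hr : RateConditions lam α γ θ)
    (hlam : ∀ n, 1 ≤ n → lam n ∈ Set.Icc (0 : ℝ) 1) {n p k : ℕ} (hn : 1 ≤ n)
    (hk : θ n ≤ p + k) : (n : ℝ) - p ≤ ∑ i ∈ Finset.range k, lam (p + i + 2) := by
  have h1 : ∑ j ∈ Finset.Icc 1 (θ n), lam (j + 1) ≤ ∑ j ∈ Finset.Icc 1 (p + k), lam (j + 1) :=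
    Finset.sum_le_sum_of_subset_of_nonneg (Finset.Icc_subset_Icc_right hk)
      fun j _ _ => (hlam (j + 1) (by omega)).1
  have h2 := (hr.diverges n hn).trans h1
  have h3 := sum_Icc_add_eq_sum_range (fun j => lam (j + 1)) 0 (p + k)
  simp only [zero_add] at h3
  rw [h3, Finset.sum_range_add] at h2
  have h4 : ∑ i ∈ Finset.range p, lam (1 + i + 1) ≤ ∑ i ∈ Finset.range p, (1 : ℝ) :=
    Finset.sum_le_sum fun i _ => (hlam (1 + i + 1) (by omega)).2
  simp only [Finset.sum_const, Finset.card_range, nsmul_eq_mul, mul_one] at h4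
  have h5 : ∑ i ∈ Finset.range k, lam (1 + (p + i) + 1)
      = ∑ i ∈ Finset.range k, lam (p + i + 2) :=
    Finset.sum_congr rfl fun i _ => by congr 1; omega
  linarith

/-- Once `θ` of the indicated argument is passed, the contraction factors `1 - lamₖ cos m` from the
index `p` on multiply to at most `exp (-w)`. -/
theorem RateConditions.le_cos_mul_sum (hr : RateConditions lam α γ θ)
    (hlam : ∀ n, 1 ≤ n → lam n ∈ Set.Icc (0 : ℝ) 1) {κ M : ℝ} (hcos : 0 < cos (M * √κ))
    {p w k : ℕ} (hw : 1 ≤ w) (hk : θ (ceilInvCos κ M * (p + w)) ≤ p + k) :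
    (w : ℝ) ≤ cos (M * √κ) * ∑ i ∈ Finset.range k, lam (p + i + 2) := by
  have hc : 1 ≤ ceilInvCos κ M * cos (M * √κ) := by
    have := Nat.le_ceil (1 / cos (M * √κ))
    rwa [div_le_iff₀ hcos] at this
  have hc1 : 0 < ceilInvCos κ M := Nat.ceil_pos.mpr (by positivity)
  have h1 := hr.sub_le_sum hlam (Nat.mul_pos hc1 (by omega : 0 < p + w)) hk
  have h2 := mul_le_mul_of_nonneg_left h1 hcos.le
  have h3 : ((p : ℝ) + w) ≤ ceilInvCos κ M * cos (M * √κ) * (p + w) :=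
    le_mul_of_one_le_left (by positivity) hc
  have h4 : cos (M * √κ) * p ≤ p := mul_le_of_le_one_left (Nat.cast_nonneg p) (cos_le_one _)
  push_cast at h2
  linarith

theorem exp_neg_max_ceil_log_le {y : ℝ} (hy : 0 < y) :
    exp (-((max ⌈log (1 / y)⌉₊ 1 : ℕ) : ℝ)) ≤ y := by
  have h1 : log (1 / y) ≤ (max ⌈log (1 / y)⌉₊ 1 : ℕ) :=
    (Nat.le_ceil _).trans (by exact_mod_cast le_max_left _ _)
  rw [one_div, log_inv] at h1
  calc exp (-((max ⌈log (1 / y)⌉₊ 1 : ℕ) : ℝ)) ≤ exp (log y) := by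
        rw [exp_le_exp, one_div, log_inv]; linarith
    _ = y := exp_log hy

end Divergence

/-! ### Asymptotic regularity of the Halpern iteration -/

section Iteration

variable {κ M : ℝ} {C : Set X} {T : X → X} {u : X} {lam : ℕ → ℝ} {α γ : ℝ → ℕ} {θ : ℕ → ℕ}
  {x : ℕ → X}

theorem IsHalpernIteration.mem {m : ℝ} (hC : SphericallyConvex κ m C) (hTC : Set.MapsTo T C C)
    (hu : u ∈ C) (hlam : ∀ n, 1 ≤ n → lam n ∈ Set.Icc (0 : ℝ) 1)
    (hx : IsHalpernIteration T lam u x) (n : ℕ) : x n ∈ C := by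
  induction n with
  | zero => rw [hx.1]; exact hu
  | succ n ih =>
    have hl := hlam (n + 1) (by omega)
    exact hC.mem u hu _ (hTC ih) _ ⟨by linarith [hl.2], by linarith [hl.1]⟩ _ (hx.2 n)

theorem IsHalpernIteration.angDist_succ_le {m : ℝ} (hC : SphericallyConvex κ m C)
    (hTC : Set.MapsTo T C C) (hT : ∀ x ∈ C, ∀ y ∈ C, dist (T x) (T y) ≤ dist x y) (hu : u ∈ C)
    (hlam : ∀ n, 1 ≤ n → lam n ∈ Set.Icc (0 : ℝ) 1)
    (hx : IsHalpernIteration T lam u x) (n : ℕ) :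
    angDist κ (x (n + 2)) (x (n + 1)) ≤
      (1 - lam (n + 2) * cos m) * angDist κ (x (n + 1)) (x n)
        + m * |lam (n + 2) - lam (n + 1)| := by
  have mx := hx.mem hC hTC hu hlam
  have h2 := hlam (n + 2) (by omega)
  have h1 := hlam (n + 1) (by omega)
  have h2' : 1 - lam (n + 2) ∈ Set.Icc (0 : ℝ) 1 := ⟨by linarith [h2.2], by linarith [h2.1]⟩
  have hm0 : 0 ≤ m := (angDist_nonneg κ _ _).trans (hC.angDist_le u hu u hu)
  have hcm := hC.cos_pos hm0
  -- move along the geodesic of the previous step to the parameter of the current one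
  obtain ⟨v, hv, hvd⟩ := hC.exists_dist_eq u hu _ (hTC (mx n)) (1 - lam (n + 1))
    ⟨by linarith [h1.2], by linarith [h1.1]⟩ (1 - lam (n + 2)) h2' _ (hx.2 n)
  have e1 := hC.angDist_convexComb_le hu (hTC (mx (n + 1))) (hTC (mx n)) h2' (hx.2 (n + 1)) hv
  rw [sub_sub_cancel] at e1
  have hk : 0 ≤ 1 - lam (n + 2) * cos m := by nlinarith [cos_le_one m, h2.1, h2.2]
  have e2 := mul_le_mul_of_nonneg_left (angDist_map_le κ hT (mx (n + 1)) (mx n)) hk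
  have e3 : angDist κ v (x (n + 1)) ≤ m * |lam (n + 2) - lam (n + 1)| := by
    rw [angDist_comm, angDist, hvd, mul_left_comm, mul_comm m]
    rw [show 1 - lam (n + 1) - (1 - lam (n + 2)) = lam (n + 2) - lam (n + 1) by ring]
    exact mul_le_mul_of_nonneg_left (hC.angDist_le u hu _ (hTC (mx n))) (abs_nonneg _)
  have e4 := angDist_triangle κ (x (n + 2)) v (x (n + 1))
  linarith

theorem IsHalpernIteration.angDist_map_le_four_mul (hC : SphericallyConvex κ (M * √κ) C)
    (hM : 0 < M) (hTC : Set.MapsTo T C C)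
    (hT : ∀ x ∈ C, ∀ y ∈ C, dist (T x) (T y) ≤ dist x y) (hu : u ∈ C)
    (hlam : ∀ n, 1 ≤ n → lam n ∈ Set.Icc (0 : ℝ) 1) (hr : RateConditions lam α γ θ)
    (hx : IsHalpernIteration T lam u x) {ℓ : ℝ} (hℓ : 0 < ℓ) {n : ℕ}
    (hn : θ (ceilInvCos κ M * (γ ℓ + max ⌈log (1 / ℓ)⌉₊ 1)) ≤ n) (hn' : α (2 * ℓ) ≤ n) :
    angDist κ (x n) (T (x n)) ≤ 4 * (M * √κ) * ℓ := by
  have mx := hx.mem hC hTC hu hlam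
  have hm : 0 < M * √κ := mul_pos hM (sqrt_pos.mpr hC.kappa_pos)
  have hcm := hC.cos_pos hm.le
  have hc1 : 0 < ceilInvCos κ M := Nat.ceil_pos.mpr (by positivity)
  set w := max ⌈log (1 / ℓ)⌉₊ 1 with hw
  have hw1 : 1 ≤ w := le_max_right _ _
  have hge := hr.le_theta hlam (Nat.mul_pos hc1 (by omega : 0 < γ ℓ + w))
  have hge' : γ ℓ + w ≤ ceilInvCos κ M * (γ ℓ + w) := Nat.le_mul_of_pos_left _ hc1
  obtain ⟨k, rfl⟩ : ∃ k, n = γ ℓ + k := ⟨n - γ ℓ, by omega⟩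
  have hk1 : 1 ≤ k := by omega
  set p := γ ℓ with hp
  have hrec := le_exp_neg_sum_mul_add_sum
    (a := fun i => angDist κ (x (p + i + 1)) (x (p + i)))
    (c := fun i => lam (p + i + 2) * cos (M * √κ))
    (τ := fun i => M * √κ * |lam (p + i + 2) - lam (p + i + 1)|)
    (fun _ => angDist_nonneg _ _ _)
    (fun i => by
      have := hlam (p + i + 2) (by omega)
      nlinarith [cos_le_one (M * √κ), this.1, this.2])
    (fun i => mul_nonneg (hlam (p + i + 2) (by omega)).1 hcm.le)
    (fun i => by positivity)
    (fun i => hx.angDist_succ_le hC hTC hT hu hlam (p + i)) k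
  simp only [add_zero] at hrec
  rw [← Finset.sum_mul, ← Finset.mul_sum, mul_comm _ (cos (M * √κ))] at hrec
  have h1 := hr.le_cos_mul_sum hlam hcm hw1 hn
  have h2 : exp (-(cos (M * √κ) * ∑ i ∈ Finset.range k, lam (p + i + 2))) ≤ ℓ :=
    (exp_le_exp.mpr (neg_le_neg h1)).trans (exp_neg_max_ceil_log_le hℓ)
  have h3 := mul_le_mul h2 (hC.angDist_le _ (mx (p + 1)) _ (mx p)) (angDist_nonneg _ _ _) hℓ.le
  have h4 : ∑ i ∈ Finset.range k, |lam (p + i + 2) - lam (p + i + 1)| ≤ ℓ := by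
    refine le_trans (le_of_eq ?_) (hr.cauchy ℓ hℓ k hk1)
    rw [sum_Icc_add_eq_sum_range (fun i => |lam (i + 1) - lam i|)]
    refine Finset.sum_congr rfl fun i _ => ?_
    rw [show p + 1 + i = p + i + 1 by omega]
  have h5 := mul_le_mul_of_nonneg_left h4 hm.le
  have h6 := IsConvexComb.angDist_right κ (hx.2 (p + k))
  rw [sub_sub_cancel] at h6
  have h7 := mul_le_mul (hr.tendsto (2 * ℓ) (by positivity) (p + k) hn')
    (hC.angDist_le u hu _ (hTC (mx (p + k)))) (angDist_nonneg _ _ _) (by positivity)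
  have h8 := angDist_triangle κ (x (p + k)) (x (p + k + 1)) (T (x (p + k)))
  rw [angDist_comm κ (x (p + k)) (x (p + k + 1))] at h8
  linarith

/-- `χ_i` is a rate of asymptotic regularity, scaled to the resolvent with parameter
`1 / (i + 1)`. -/
theorem IsHalpernIteration.angDist_map_le_of_chi_le (hC : SphericallyConvex κ (M * √κ) C)
    (hM : 0 < M) (hTC : Set.MapsTo T C C)
    (hT : ∀ x ∈ C, ∀ y ∈ C, dist (T x) (T y) ≤ dist x y) (hu : u ∈ C)
    (hlam : ∀ n, 1 ≤ n → lam n ∈ Set.Icc (0 : ℝ) 1) (hr : RateConditions lam α γ θ)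
    (hx : IsHalpernIteration T lam u x) {i : ℕ} {δ : ℝ} (hδ : 0 < δ) {n : ℕ}
    (hn : chi κ M θ α γ i δ ≤ n) :
    angDist κ (x n) (T (x n)) ≤ cos (M * √κ) * δ * (1 / ((i : ℝ) + 1)) := by
  have hs : 0 < √κ := sqrt_pos.mpr hC.kappa_pos
  have hcm := hC.cos_pos (mul_pos hM hs).le
  have hL : 0 < L κ M i δ := by rw [L]; positivity
  have h1 := hx.angDist_map_le_four_mul hC hM hTC hT hu hlam hr hL
    ((le_max_left _ _).trans hn) ((le_max_right _ _).trans hn)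
  refine h1.trans (le_of_eq ?_)
  rw [L]
  field_simp

end Iteration

/-! ### Comparison of the iteration with the resolvents -/

theorem cos_sub_le_cos {a b η : ℝ} (haπ : a ≤ π) (hb : 0 ≤ b) (hη : 0 ≤ η)
    (h : b ≤ a + η) : cos a - η ≤ cos b := by
  rcases le_total b a with hba | hab
  · linarith [cos_le_cos_of_nonneg_of_le_pi hb haπ hba]
  · have h1 := abs_cos_sub_cos_le a b
    rw [abs_sub_comm a b, abs_of_nonneg (sub_nonneg.mpr hab)] at h1
    linarith [(abs_le.mp h1).2]

namespace SphericallyConvex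

variable {κ m : ℝ} {C : Set X} {T : X → X} {u : X}

theorem sin_nonneg (hC : SphericallyConvex κ m C) {v : ℝ} (h0 : 0 ≤ v) (hv : v ≤ m) :
    0 ≤ sin v :=
  sin_nonneg_of_nonneg_of_le_pi h0 (by linarith [hC.lt_pi_div_two, pi_pos])

/-- Approximate variational inequality: seen from the resolvent `z`, the anchor `u` and an almost
fixed point `x` span an angle of almost at least `π / 2`. -/
theorem cos_anchor_le (hC : SphericallyConvex κ m C)
    (hTC : Set.MapsTo T C C) (hT : ∀ x ∈ C, ∀ y ∈ C, dist (T x) (T y) ≤ dist x y) (hu : u ∈ C)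
    {t : ℝ} (ht : t ∈ Set.Ioc (0 : ℝ) 1) {z x : X} (hz : z ∈ C) (hx : x ∈ C)
    (hzr : IsResolvent T u t z) :
    cos (angDist κ u x) ≤ cos (angDist κ u z) * cos (angDist κ x z)
      + angDist κ x (T x) / t := by
  have hpi := pi_pos
  have hm2 := hC.lt_pi_div_two
  have hη : 0 ≤ angDist κ x (T x) := angDist_nonneg _ _ _
  have hA := angDist_nonneg κ u (T z)
  have hAm := hC.angDist_le u hu _ (hTC hz)
  have hza := IsConvexComb.angDist_left κ hzr
  rcases hA.eq_or_lt with h0 | hApos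
  · rw [← h0, mul_zero] at hza
    have huz := hC.eq_of_angDist_eq_zero hza
    rw [hza, cos_zero, one_mul, angDist_comm κ x z, ← huz]
    exact le_add_of_nonneg_right (div_nonneg hη ht.1.le)
  have h1 := hC.cos_le x hx u hu _ (hTC hz) (1 - t) ⟨by linarith [ht.2], by linarith [ht.1]⟩ z hzr
  rw [sub_sub_cancel, ← hza, angDist_comm κ x u] at h1
  have hxz : cos (angDist κ x z) - angDist κ x (T x) ≤ cos (angDist κ x (T z)) := by
    refine cos_sub_le_cos
      (by linarith [hC.angDist_le x hx z hz]) (angDist_nonneg _ _ _) hη ?_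
    linarith [angDist_triangle κ x (T x) (T z), angDist_map_le κ hT hx hz]
  have ca : 0 ≤ cos (angDist κ x z) := cos_nonneg_of_mem_Icc
    ⟨by linarith [angDist_nonneg κ x z], by linarith [hC.angDist_le x hx z hz]⟩
  have ham := hC.angDist_le u hu z hz
  have ha0 := angDist_nonneg κ u z
  set A := angDist κ u (T z)
  set a := angDist κ u z
  set e := cos (angDist κ x z)
  set η := angDist κ x (T x)
  have htA : t * A ≤ A := mul_le_of_le_one_left hA ht.2
  have htA0 : 0 < t * A := mul_pos ht.1 hApos
  have st : 0 < sin (t * A) := sin_pos_of_pos_of_lt_pi htA0 (by linarith)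
  have sa : 0 ≤ sin a := hC.sin_nonneg ha0 ham
  have hsinA : sin A - sin a ≤ sin (t * A) * cos a := by
    have hA' : A = a + t * A := by rw [hza]; ring
    have h2 : sin A = sin a * cos (t * A) + cos a * sin (t * A) := by rw [← sin_add, ← hA']
    have h3 := mul_le_mul_of_nonneg_left (cos_le_one (t * A)) sa
    linarith
  have hsa : sin a ≤ sin (t * A) / t := by
    rw [le_div_iff₀ ht.1]
    have h2 : t * sin A ≤ sin (t * A) :=
      mul_sin_le_sin_mul ⟨ht.1.le, ht.2⟩ ⟨hA, by linarith⟩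
    have h3 : sin a ≤ sin A := sin_le_sin_of_le_of_le_pi_div_two (by linarith) (by linarith)
      (by rw [hza]; linarith)
    have h4 := mul_le_mul_of_nonneg_left h3 ht.1.le
    linarith
  refine le_of_mul_le_mul_left ?_ st
  have h2 := mul_le_mul_of_nonneg_left hxz sa
  have h3 := mul_le_mul_of_nonneg_right hsinA ca
  have h4 := mul_le_mul_of_nonneg_right hsa hη
  have h5 : sin (t * A) * (cos a * e + η / t) = sin (t * A) * cos a * e + sin (t * A) / t * η := by
    ring
  rw [h5]
  linarith

/-- One step of the iteration, measured against an almost fixed point `p` that almost satisfies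
the variational inequality with defect `ω`: above the level `ω / cos m`, the quantity
`1 - cos d(x, p)` contracts by the factor `1 - l cos m`, up to the displacement of `p`. -/
theorem halpern_step (hC : SphericallyConvex κ m C)
    (hTC : Set.MapsTo T C C) (hT : ∀ x ∈ C, ∀ y ∈ C, dist (T x) (T y) ≤ dist x y) (hu : u ∈ C)
    {l : ℝ} (hl : l ∈ Set.Icc (0 : ℝ) 1) {x y p : X} (hx : x ∈ C) (hp : p ∈ C)
    (hy : IsConvexComb (1 - l) u (T x) y) {ω : ℝ} (hω : 0 ≤ ω)
    (h : cos (angDist κ u y) ≤ cos (angDist κ u p) + ω) :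
    max (1 - cos (angDist κ y p) - ω / cos m) 0
      ≤ (1 - l * cos m) * max (1 - cos (angDist κ x p) - ω / cos m) 0 + angDist κ p (T p) := by
  have hpi := pi_pos
  have hm2 := hC.lt_pi_div_two
  have hl' : 1 - l ∈ Set.Icc (0 : ℝ) 1 := ⟨by linarith [hl.2], by linarith [hl.1]⟩
  have hm0 : 0 ≤ m := (angDist_nonneg κ u u).trans (hC.angDist_le u hu u hu)
  have hcm := hC.cos_pos hm0
  have hk : 0 ≤ 1 - l * cos m := by nlinarith [cos_le_one m, hl.1, hl.2]
  have hζ := angDist_nonneg κ p (T p)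
  have hmax : 0 ≤ max (1 - cos (angDist κ x p) - ω / cos m) 0 := le_max_right _ _
  have hrhs := add_nonneg (mul_nonneg hk hmax) hζ
  refine max_le ?_ hrhs
  have hya := hy.angDist_left κ
  have hD := angDist_nonneg κ u (T x)
  have hDm := hC.angDist_le u hu _ (hTC hx)
  have hωm : ω ≤ ω / cos m := by
    rw [le_div_iff₀ hcm]; exact mul_le_of_le_one_right hω (cos_le_one m)
  rcases hD.eq_or_lt with h0 | hDpos
  · rw [← h0, mul_zero] at hya
    have huy := hC.eq_of_angDist_eq_zero hya
    rw [hya, cos_zero, huy] at h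
    linarith
  have h1 := hC.cos_le p hp u hu _ (hTC hx) (1 - l) hl' y hy
  rw [sub_sub_cancel, ← hya, angDist_comm κ p u, angDist_comm κ p y] at h1
  have hpv : cos (angDist κ x p) - angDist κ p (T p) ≤ cos (angDist κ p (T x)) := by
    refine cos_sub_le_cos
      (by linarith [hC.angDist_le x hx p hp]) (angDist_nonneg _ _ _) hζ ?_
    have := angDist_map_le κ hT hp hx
    rw [angDist_comm κ p x] at this
    linarith [angDist_triangle κ p (T p) (T x)]
  have hρ0 := angDist_nonneg κ u y
  have hρm := hC.angDist_le u hu y (hC.mem u hu _ (hTC hx) _ hl' y hy)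
  have hsρ : sin (angDist κ u y) ≤ (1 - l * cos m) * sin (angDist κ u (T x)) := by
    have := sin_mul_le hl' hD hDm hm2.le
    rwa [sub_sub_cancel, ← hya] at this
  set D := angDist κ u (T x)
  set ρ := angDist κ u y
  set ζ := angDist κ p (T p)
  set Q := max (1 - cos (angDist κ x p) - ω / cos m) 0 with hQ
  have sD : 0 < sin D := sin_pos_of_pos_of_lt_pi hDpos (by linarith)
  have sρ : 0 ≤ sin ρ := hC.sin_nonneg hρ0 hρm
  have hlD : l * D ≤ D := mul_le_of_le_one_left hD hl.2
  have slD : 0 ≤ sin (l * D) := hC.sin_nonneg (mul_nonneg hl.1 hD) (hlD.trans hDm)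
  have hDρ : D = ρ + l * D := by rw [hya]; ring
  have hup : sin D - sin ρ ≤ sin (l * D) * cos ρ := by
    have h2 : sin D = sin ρ * cos (l * D) + cos ρ * sin (l * D) := by rw [← sin_add, ← hDρ]
    have h3 := mul_le_mul_of_nonneg_left (cos_le_one (l * D)) sρ
    linarith
  have hlow : cos m * sin (l * D) ≤ sin D - sin ρ := by
    have h2 : sin ρ = sin D * cos (l * D) - cos D * sin (l * D) := by
      rw [← sin_sub]; congr 1; linarith
    have h3 := mul_le_mul_of_nonneg_left (cos_le_one (l * D)) sD.le
    have h4 := mul_le_mul_of_nonneg_right (cos_le_cos_of_nonneg_of_le_pi hD (by linarith) hDm) slD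
    linarith
  have hbr : sin (l * D) * ω ≤ (sin D - sin ρ) * (ω / cos m) := by
    have h2 := mul_le_mul_of_nonneg_right hlow (div_nonneg hω hcm.le)
    have h3 : cos m * sin (l * D) * (ω / cos m) = sin (l * D) * ω := by field_simp
    linarith
  refine le_of_mul_le_mul_left ?_ sD
  have h2 := mul_le_mul_of_nonneg_left hpv sρ
  have h3 := mul_le_mul_of_nonneg_left h slD
  have h4 : 1 - cos (angDist κ x p) - ω / cos m ≤ Q := le_max_left _ _
  have h5 := mul_le_mul_of_nonneg_left h4 sρ
  have h6 := mul_le_mul_of_nonneg_right hsρ (add_nonneg hmax hζ)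
  have h7 : (1 - l * cos m) * sin D * ζ ≤ sin D * ζ :=
    mul_le_mul_of_nonneg_right
      (mul_le_of_le_one_left sD.le (by linarith [mul_nonneg hl.1 hcm.le])) hζ
  linarith

end SphericallyConvex

variable {κ M : ℝ} {C : Set X} {T : X → X} {u : X} {lam : ℕ → ℝ}
  {α γ : ℝ → ℕ} {θ : ℕ → ℕ} {x : ℕ → X}

/-! ### The constants of the rate of metastability -/

theorem RateConditions.one_le_chiStar (hr : RateConditions lam α γ θ) (hκ : 0 < κ) (hM : 0 < M)
    (hcos : 0 < cos (M * √κ)) {δ : ℝ} (hδ : 0 < δ) (i : ℕ) : 1 ≤ chiStar κ M θ α γ i δ := by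
  have hs : 0 < √κ := sqrt_pos.mpr hκ
  refine (hr.alpha_pos _ ?_).trans (le_max_right _ _)
  rw [L]
  positivity

theorem RateConditions.chiStar_lt_Theta (hr : RateConditions lam α γ θ)
    (hlam : ∀ n, 1 ≤ n → lam n ∈ Set.Icc (0 : ℝ) 1) (hcos : 0 < cos (M * √κ)) (i : ℕ) (δ : ℝ) :
    chiStar κ M θ α γ i (δ / 3) < Theta κ M θ α γ i δ := by
  have hc1 : 0 < ceilInvCos κ M := Nat.ceil_pos.mpr (by positivity)
  have hw1 : 1 ≤ max (logTerm κ M δ) 1 := le_max_right _ _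
  have h1 := hr.le_theta hlam (Nat.mul_pos hc1
    (by omega : 0 < chiStar κ M θ α γ i (δ / 3) - 1 + max (logTerm κ M δ) 1))
  have h2 := Nat.le_mul_of_pos_left
    (chiStar κ M θ α γ i (δ / 3) - 1 + max (logTerm κ M δ) 1) hc1
  rw [Theta]
  omega

theorem Theta_le_A (ε : ℝ) (hcos : 0 < cos (M * √κ)) {i n : ℕ} (hi : ceilInvEps0 ε κ M ≤ i)
    (hin : i ≤ n) : Theta κ M θ α γ i (sin (ε * √κ / 4) ^ 2) ≤ A ε κ M θ α γ n := by
  have hc1 : 0 < ceilInvCos κ M := Nat.ceil_pos.mpr (by positivity)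
  have hS : logTerm κ M (sin (ε * √κ / 4) ^ 2) = S ε κ M := by
    rw [logTerm, S, div_mul_eq_mul_div]
  have hΓ : chiStar κ M θ α γ i (sin (ε * √κ / 4) ^ 2 / 3) ≤ Gamma ε κ M θ α γ n := by
    have := Finset.le_sup (f := fun i => chiStar κ M θ α γ i (1 / 3 * sin (ε * √κ / 4) ^ 2))
      (Finset.mem_Icc.mpr ⟨hi, hin⟩)
    simp only [one_div_mul_eq_div] at this
    simpa only [Gamma, one_div_mul_eq_div] using this
  rw [Theta, A, hS, thetaPlus]
  refine Nat.add_le_add_right (Finset.le_sup (f := θ) (Finset.mem_Icc.mpr ⟨?_, ?_⟩)) 1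
  · exact Nat.mul_pos hc1 (by have := le_max_right (S ε κ M) 1; omega)
  · exact Nat.mul_le_mul_left _ (by omega)

/-! ### Metastability of the iteration -/

/-- If two resolvents `z` and `p` are close, where `z` has the parameter `1 / (i + 1)` and `p` is
fixed by `T` up to the error `Δ*`, then the iteration stays near `p` on `[Θ, Θ + g Θ]`. The
resolvent `z` enters through the variational inequality, whose error is divided by its parameter,
and `p` through its small displacement, which is summed over all steps. -/
theorem IsHalpernIteration.one_sub_cos_le (hC : SphericallyConvex κ (M * √κ) C) (hM : 0 < M)
    (hTC : Set.MapsTo T C C) (hT : ∀ x ∈ C, ∀ y ∈ C, dist (T x) (T y) ≤ dist x y) (hu : u ∈ C)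
    (hlam : ∀ n, 1 ≤ n → lam n ∈ Set.Icc (0 : ℝ) 1) (hr : RateConditions lam α γ θ)
    (hx : IsHalpernIteration T lam u x) {σ : ℝ} (hσ : 0 < σ) (g : ℕ → ℕ) {i : ℕ} {z p : X}
    (hz : z ∈ C) (hp : p ∈ C) (hzr : IsResolvent T u (1 / ((i : ℝ) + 1)) z)
    (hzp : angDist κ z p ≤ cos (M * √κ) / 36 * σ)
    (hpT : angDist κ p (T p) ≤ DeltaStar κ M θ α γ i σ g) {n : ℕ}
    (hn : Theta κ M θ α γ i σ ≤ n)
    (hn' : n ≤ Theta κ M θ α γ i σ + g (Theta κ M θ α γ i σ)) :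
    1 - cos (angDist κ (x n) p) ≤ 2 * σ := by
  have hpi := pi_pos
  have hm2 := hC.lt_pi_div_two
  have hm : 0 < M * √κ := mul_pos hM (sqrt_pos.mpr hC.kappa_pos)
  have hcm := hC.cos_pos hm.le
  have mx := hx.mem hC hTC hu hlam
  have hi0 : (0 : ℝ) < (i : ℝ) + 1 := by positivity
  have hχ1 := hr.one_le_chiStar hC.kappa_pos hM hcm (δ := σ / 3) (by positivity) i
  have hχΘ := hr.chiStar_lt_Theta hlam hcm i σ
  set c := cos (M * √κ) with hc
  set χ := chiStar κ M θ α γ i (σ / 3) with hχ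
  set Θ := Theta κ M θ α γ i σ with hΘ
  set w := max (logTerm κ M σ) 1 with hw
  set ζ := angDist κ p (T p) with hζ
  have hζ0 : 0 ≤ ζ := angDist_nonneg _ _ _
  set ω := c / 36 * σ + c * (σ / 3 / 2 * c) with hω
  have hω0 : 0 ≤ ω := by positivity
  obtain ⟨q, hq⟩ : ∃ q, χ = q + 1 := ⟨χ - 1, by omega⟩
  obtain ⟨k, rfl⟩ : ∃ k, n = q + (k + 1) := ⟨n - q - 1, by omega⟩
  -- the variational inequality holds at every index from `χ = q + 1` on
  have hvar : ∀ j, cos (angDist κ u (x (q + j + 1))) ≤ cos (angDist κ u p) + ω := by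
    intro j
    have h1 := hC.cos_anchor_le hTC hT hu (t := 1 / ((i : ℝ) + 1))
      ⟨by positivity, by rw [div_le_one hi0]; linarith [(Nat.cast_nonneg i : (0 : ℝ) ≤ i)]⟩
      hz (mx (q + j + 1)) hzr
    have h2 := hx.angDist_map_le_of_chi_le hC hM hTC hT hu hlam hr (i := i)
      (δ := σ / 3 / 2 * c) (by positivity) (n := q + j + 1)
      (by change χ ≤ _; omega)
    rw [← div_le_iff₀ (by positivity), ← hc] at h2
    have h3 : cos (angDist κ u z) * cos (angDist κ (x (q + j + 1)) z) ≤ cos (angDist κ u z) :=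
      mul_le_of_le_one_right (cos_nonneg_of_mem_Icc
        ⟨by linarith [angDist_nonneg κ u z], by linarith [hC.angDist_le u hu z hz]⟩) (cos_le_one _)
    have h4 : cos (angDist κ u z) - angDist κ z p ≤ cos (angDist κ u p) :=
      cos_sub_le_cos (by linarith [hC.angDist_le u hu z hz]) (angDist_nonneg _ _ _)
        (angDist_nonneg _ _ _) (angDist_triangle _ _ _ _)
    linarith
  have hrec := le_exp_neg_sum_mul_add_sum
    (a := fun j => max (1 - cos (angDist κ (x (q + j)) p) - ω / c) 0)
    (c := fun j => lam (q + j + 1) * c) (τ := fun _ => ζ)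
    (fun _ => le_max_right _ _)
    (fun j => by
      have := hlam (q + j + 1) (by omega)
      nlinarith [cos_le_one (M * √κ), this.1, this.2])
    (fun j => mul_nonneg (hlam (q + j + 1) (by omega)).1 hcm.le)
    (fun _ => hζ0)
    (fun j => hC.halpern_step hTC hT hu (hlam (q + j + 1) (by omega)) (mx (q + j)) hp
      (hx.2 (q + j)) hω0 (hvar j)) (k + 1)
  simp only [add_zero, Finset.sum_const, Finset.card_range, nsmul_eq_mul] at hrec
  -- the contribution of the initial distance
  have hsin : 0 < sin (M * √κ / 2) := sin_pos_of_pos_of_lt_pi (by linarith) (by linarith)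
  have hinit : max (1 - cos (angDist κ (x q) p) - ω / c) 0 ≤ 2 * sin (M * √κ / 2) ^ 2 := by
    refine max_le ?_ (by positivity)
    have h1 : cos (M * √κ) ≤ cos (angDist κ (x q) p) :=
      cos_le_cos_of_nonneg_of_le_pi (angDist_nonneg _ _ _) (by linarith)
        (hC.angDist_le _ (mx q) p hp)
    have h2 : 0 ≤ ω / c := by positivity
    rw [← one_sub_cos_eq]
    linarith
  have hsum : (w : ℝ) ≤ ∑ j ∈ Finset.range (k + 1), lam (q + j + 1) * c := by
    have h1 : θ (ceilInvCos κ M * (q + w)) ≤ q + k := by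
      have h2 : Θ = θ (ceilInvCos κ M * (χ - 1 + w)) + 1 := rfl
      rw [hq, add_tsub_cancel_right] at h2
      omega
    have h3 := hr.le_cos_mul_sum hlam hcm (le_max_right _ _) h1
    rw [← Finset.sum_mul, Finset.sum_range_succ', mul_comm _ c]
    refine h3.trans (mul_le_mul_of_nonneg_left ?_ hcm.le)
    have h4 := (hlam (q + 0 + 1) (by omega)).1
    have h5 : ∑ j ∈ Finset.range k, lam (q + (j + 1) + 1)
        = ∑ j ∈ Finset.range k, lam (q + j + 2) := rfl
    rw [h5]
    linarith
  have hexp : exp (-∑ j ∈ Finset.range (k + 1), lam (q + j + 1) * c)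
      ≤ σ / (3 * sin (M * √κ / 2) ^ 2) := by
    refine (exp_le_exp.mpr (neg_le_neg hsum)).trans ?_
    have h1 := exp_neg_max_ceil_log_le (y := σ / (3 * sin (M * √κ / 2) ^ 2)) (by positivity)
    have h2 : 1 / (σ / (3 * sin (M * √κ / 2) ^ 2)) = 3 / σ * sin (M * √κ / 2) ^ 2 := by
      field_simp
    rwa [h2] at h1
  have hfirst := mul_le_mul hexp hinit (le_max_right _ _) (by positivity)
  have hfirst' : σ / (3 * sin (M * √κ / 2) ^ 2) * (2 * sin (M * √κ / 2) ^ 2) = 2 / 3 * σ := by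
    field_simp
  -- the accumulated displacement of `p`
  have hthird : ((k + 1 : ℕ) : ℝ) * ζ ≤ 2 / 3 * σ := by
    have h1 : ((k : ℝ) + 1) + q ≤ (Θ : ℝ) + g Θ := by
      have : k + 1 + q ≤ Θ + g Θ := by omega
      exact_mod_cast this
    have h2 : (χ : ℝ) + 1 ≤ Θ := by exact_mod_cast hχΘ
    have h3 : (χ : ℝ) = q + 1 := by rw [hq]; push_cast; ring
    have h4 : (0 : ℝ) ≤ g Θ := Nat.cast_nonneg _
    have hden : 0 < 3 * (Θ : ℝ) - 3 * χ + 3 * g Θ := by linarith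
    have h5 : ζ * (3 * (Θ : ℝ) - 3 * χ + 3 * g Θ) ≤ σ := by
      rw [← le_div_iff₀ hden]
      exact hpT
    have h6 : ((k : ℝ) + 1) ≤ 2 / 3 * (3 * (Θ : ℝ) - 3 * χ + 3 * g Θ) := by linarith
    have h7 := mul_le_mul_of_nonneg_right h6 hζ0
    push_cast
    linarith
  -- the defect in the variational inequality
  have hsecond : ω / c ≤ 2 / 3 * σ := by
    rw [div_le_iff₀ hcm, hω]
    have : c ≤ 1 := cos_le_one _
    nlinarith [mul_pos hσ hcm]
  have hlast := (le_max_left (1 - cos (angDist κ (x (q + (k + 1))) p) - ω / c) 0).trans hrec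
  linarith

theorem angDist_le_half_of_one_sub_cos_le {y p : X} {ε : ℝ} (hε : 0 ≤ ε)
    (hπ : angDist κ y p ≤ π) (h : 1 - cos (angDist κ y p) ≤ 2 * sin (ε * √κ / 4) ^ 2) :
    angDist κ y p ≤ ε * √κ / 2 := by
  by_contra! hlt
  have h1 := cos_lt_cos_of_nonneg_of_le_pi (by positivity) hπ hlt
  have h2 := one_sub_cos_eq (ε * √κ / 2)
  rw [show ε * √κ / 2 / 2 = ε * √κ / 4 by ring] at h2
  linarith

end

end Halpern

theorem mainTheorem1 {X : Type*} [MetricSpace X] [CompleteSpace X]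
    (κ : ℝ) (hκ : 0 < κ) (hX : Halpern.IsCAT κ X)
    (C : Set X) (hC_bounded : Bornology.IsBounded C) (hC_closed : IsClosed C)
    (hC_convex : Halpern.GeodesicConvex C)
    (T : X → X) (hTC : Set.MapsTo T C C)
    (hT : ∀ x ∈ C, ∀ y ∈ C, dist (T x) (T y) ≤ dist x y)
    (M : ℝ) (hM_pos : 0 < M) (hM_lt : M < Halpern.modelDiam κ / 2) (hM : Metric.diam C ≤ M)
    (lam : ℕ → ℝ) (hlam : ∀ n, 1 ≤ n → lam n ∈ Set.Icc (0 : ℝ) 1)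
    (α γ : ℝ → ℕ) (θ : ℕ → ℕ) (hrates : Halpern.RateConditions lam α γ θ)
    (u : X) (hu : u ∈ C) (x : ℕ → X) (hx : Halpern.IsHalpernIteration T lam u x)
    (ε : ℝ) (hε : ε ∈ Set.Ioo (0 : ℝ) 2) (hε_sin : Real.sin (ε * √κ / 4) ≠ 0)
    (g : ℕ → ℕ) :
    ∃ N K₀ : ℕ,
      Halpern.ceilInvEps0 ε κ M ≤ K₀ ∧
      K₀ ≤ (Halpern.fTilde ε g κ M θ α γ)^[Halpern.B ε κ M] 0 + Halpern.ceilInvEps0 ε κ M ∧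
      N = Halpern.Theta κ M θ α γ K₀ (Real.sin (ε * √κ / 4) ^ 2) ∧
      N ≤ Halpern.metastabilityRate ε g κ M θ α γ ∧
      ∀ m ∈ Set.Icc N (N + g N), ∀ n ∈ Set.Icc N (N + g N), dist (x n) (x m) ≤ ε := by
  open Halpern Real in
  have hpi := pi_pos
  have hs : 0 < √κ := sqrt_pos.mpr hκ
  have hC := sphericallyConvex_of_isCAT hκ hX hC_convex hM_lt
    fun x hx y hy => (Metric.dist_le_diam_of_mem hC_bounded hx hy).trans hM
  have hm : 0 < M * √κ := mul_pos hM_pos hs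
  have hm2 := hC.lt_pi_div_two
  have hcos := hC.cos_pos hm.le
  have mx := hx.mem hC hTC hu hlam
  have hσ : 0 < sin (ε * √κ / 4) ^ 2 := by positivity
  have hη : 0 < eps0 ε κ M := by rw [eps0]; positivity
  have hηπ : eps0 ε κ M ≤ π := by
    rw [eps0]
    nlinarith [cos_le_one (M * √κ), sin_sq_le_one (ε * √κ / 4), pi_gt_three]
  have hres : ∀ i : ℕ, ∃ z ∈ C, IsResolvent T u (1 / ((i : ℝ) + 1)) z := fun i =>
    hC.exists_isResolvent hm.le hC_closed hTC hT hu ⟨by positivity, by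
      rw [div_le_one (by positivity)]; linarith [(Nat.cast_nonneg i : (0 : ℝ) ≤ i)]⟩
  choose z hzC hzr using hres
  obtain ⟨K, hK, hclose⟩ := hC.resolvent_metastable hm hTC hT hu hzC hzr hη hηπ
    (fTilde ε g κ M θ α γ) fun i => Nat.le_add_right _ _
  set e := ceilInvEps0 ε κ M with he
  set J := K + e + f ε g κ M θ α γ (K + e) with hJ
  have hKJ : fTilde ε g κ M θ α γ K = J := by
    rw [fTilde, fStar, ← he, hJ]; omega
  have hzp := (hclose (K + e) J (by omega) (by omega) hKJ.ge).1
  have hΘ := hrates.chiStar_lt_Theta hlam hcos (K + e) (sin (ε * √κ / 4) ^ 2)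
  have hΔ : 0 < DeltaStar κ M θ α γ (K + e) (sin (ε * √κ / 4) ^ 2) g := by
    have h1 : (chiStar κ M θ α γ (K + e) (sin (ε * √κ / 4) ^ 2 / 3) : ℝ)
        < Theta κ M θ α γ (K + e) (sin (ε * √κ / 4) ^ 2) := by exact_mod_cast hΘ
    refine div_pos hσ ?_
    have h2 : (0 : ℝ) ≤ g (Theta κ M θ α γ (K + e) (sin (ε * √κ / 4) ^ 2)) := Nat.cast_nonneg _
    linarith
  have hpT : angDist κ (z J) (T (z J))
      ≤ DeltaStar κ M θ α γ (K + e) (sin (ε * √κ / 4) ^ 2) g := by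
    have h1 := IsConvexComb.angDist_right κ (hzr J)
    rw [sub_sub_cancel] at h1
    have h2 : M * √κ / DeltaStar κ M θ α γ (K + e) (sin (ε * √κ / 4) ^ 2) g ≤ (J : ℝ) := by
      refine (Nat.le_ceil _).trans ?_
      have h3 : ⌈M * √κ / DeltaStar κ M θ α γ (K + e) (sin (ε * √κ / 4) ^ 2) g⌉₊ ≤ J := by
        rw [hJ, f]; omega
      exact_mod_cast h3
    rw [div_le_iff₀ hΔ] at h2
    have h4 := hC.angDist_le u hu _ (hTC (hzC J))
    rw [h1, one_div_mul_eq_div, div_le_iff₀ (by positivity)]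
    linarith
  refine ⟨_, K + e, Nat.le_add_left _ _, Nat.add_le_add_right hK _, rfl,
    Theta_le_A ε hcos (Nat.le_add_left _ _) (Nat.add_le_add_right hK _), ?_⟩
  have hnear : ∀ n ∈ Set.Icc (Theta κ M θ α γ (K + e) (sin (ε * √κ / 4) ^ 2))
      (Theta κ M θ α γ (K + e) (sin (ε * √κ / 4) ^ 2)
        + g (Theta κ M θ α γ (K + e) (sin (ε * √κ / 4) ^ 2))),
      angDist κ (x n) (z J) ≤ ε * √κ / 2 := fun n hn =>
    angDist_le_half_of_one_sub_cos_le hε.1.le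
      (by linarith [hC.angDist_le _ (mx n) _ (hzC J)])
      (hx.one_sub_cos_le hC hM_pos hTC hT hu hlam hrates hσ g (hzC (K + e)) (hzC J) (hzr (K + e))
        hzp hpT hn.1 hn.2)
  intro m hm n hn
  have h1 := angDist_triangle κ (x n) (z J) (x m)
  have h2 := hnear n hn
  have h3 := hnear m hm
  rw [angDist_comm] at h3
  have h4 : √κ * dist (x n) (x m) ≤ √κ * ε := by
    rw [← angDist]; linarith
  exact le_of_mul_le_mul_left h4 hs
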